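/- Let $M>0$ and $\alpha>0$ and consider the Euclidean Kerr metric in coordinates $(t,r,\theta,\phi)$, $$g=\Xi\Big(\frac{dr^2}{\Delta}+d\theta^2\Big)+\frac{\sin^2\theta}{\Xi}\big(\alpha\,dt+(r^2-\alpha^2)\,d\phi\big)^2+\frac{\Delta}{\Xi}\big(dt-\alpha\sin^2\theta\,d\phi\big)^2,$$ $$\Delta=r^2-2Mr-\alpha^2,\qquad \Xi=r^2-\alpha^2\cos^2\theta,$$ on the domain $U=\{\Delta>0,\ \Xi>0,\ 0<\theta<\pi\}$ (which contains the exterior region $r>M+\sqrt{M^2+\alpha^2}$, $0<\theta<\pi$). Let $$e^1=\sqrt{\tfrac{\Xi}{\Delta}}\,dr,\quad e^2=\sqrt{\Xi}\,d\theta,\quad e^3=\tfrac{\sin\theta}{\sqrt\Xi}\big(\alpha\,dt+(r^2-\alpha^2)\,d\phi\big),\quad e^4=\sqrt{\tfrac{\Delta}{\Xi}}\,\big(dt-\alpha\sin^2\theta\,d\phi\big)$$ be the orthonormal coframe, with dual frame $e_1,\dots,e_4$ and orientation $e^1\wedge e^2\wedge e^3\wedge e^4$. Let $\Omega_1=e^1\wedge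 e^2+e^3\wedge e^4$, $\Omega_2=e^1\wedge e^3+e^4\wedge e^2$, $\Omega_3=e^1\wedge e^4+e^2\wedge e^3$ be the corresponding basis of the self-dual two-forms $\Lambda^2_+$. The curvature operator on two-forms is $\mathcal R(e^a\wedge e^b)=\frac12\sum_{c,d}R_{abcd}\,e^c\wedge e^d$, where $R_{abcd}=g(R(e_a,e_b)e_d,e_c)$ (it is the identity on the unit sphere); the Weyl operator is defined in the same way from the Weyl tensor. Let $A$ and $W^+$ be the $3\times 3$ matrices, in the basis $\Omega_1,\Omega_2,\Omega_3$, of the $\Lambda^2_+\to\Lambda^2_+$ blocks of the curvature operator and of the Weyl operator, and let $|W^+|^2=\sum_{i=1}^3\lambda_i^2$, where $\lambda_1,\lambda_2,\lambda_3$ are the eigenvalues of $W^+$ with multiplicity. Let $J$ be the almost complex structure $Je_1=e_4$, $Je_2=e_3$, $Je_3=-e_2$, $Je_4=-e_1$, let $\omega(X,Y)=g(JX,Y)$, so that $\omega=e^1\wedge e^4+e^2\wedge e^3$, and let $\xi$ be the Lee form of $(g,J)$, $\xi_i=-(\nabla_aJ_b{}^a)J_i{}^b$, where $J\partial_b=J_b{}^c\,\partial_c$.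 Then the following hold on $U$. 1. The Ricci tensor and the scalar curvature $R$ vanish, and $$A=W^++\frac{R}{12}I=W^+=\operatorname{diag}\Big(-\frac{M}{(r-\alpha\cos\theta)^3},\,-\frac{M}{(r-\alpha\cos\theta)^3},\,\frac{2M}{(r-\alpha\cos\theta)^3}\Big)\neq 0 .$$ Moreover, $\Omega_1,\Omega_2,\Omega_3$ are eigenforms of the full Weyl operator on two-forms, with these eigenvalues. In particular, $W^+$ has at each point exactly two distinct eigenvalues. 2. $|W^+|^{2/3}=\dfrac{6^{1/3}M^{2/3}}{(r-\alpha\cos\theta)^2}.$ 3. $\xi=\dfrac{2(dr+\alpha\sin\theta\,d\theta)}{r-\alpha\cos\theta}=d\log\big(C(r-\alpha\cos\theta)^2\big)$ for every constant $C>0$, and at each point $\xi$ is the unique covector with $d\omega=\xi\wedge\omega$. 4. The function $|W^+|^{2/3}$ agrees up to a constant with the conformal factor obtained from the exact Lee form. The potential $\log\big((r-\alpha\cos\theta)^2\big)$ gives the factor $\exp\big(-\log (r-\alpha\cos\theta)^2\big)=(r-\alpha\cos\theta)^{-2}$, and $$|W^+|^{2/3}=\exp\big(-\log\big(C(r-\alpha\cos\theta)^2\big)\big)\quad\text{for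 } C=6^{-1/3}M^{-2/3}.$$ More generally, if $V\subseteq U$ is open and connected and $\xi=df$ on $V$, then there is a constant $c>0$ with $|W^+|^{2/3}=c\,e^{-f}$ on $V$. -/

import Mathlib

/-! ### Riemannian geometry in a four-dimensional coordinate chart

A tensor field is given by its coordinate components, as functions of the point
`x : Fin 4 → ℝ` of the chart. -/

/-- The partial derivative `∂f/∂xⁱ` at `x`. -/
noncomputable def pd (i : Fin 4) (f : (Fin 4 → ℝ) → ℝ) (x : Fin 4 → ℝ) : ℝ :=
  deriv (fun s => f (Function.update x i s)) (x i)

/-- Christoffel symbols `Γᵏᵢⱼ` of the Levi-Civita connection of the metric `g`. -/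
noncomputable def christoffel (g : (Fin 4 → ℝ) → Matrix (Fin 4) (Fin 4) ℝ)
    (k i j : Fin 4) (x : Fin 4 → ℝ) : ℝ :=
  (1 / 2) * ∑ l, (g x)⁻¹ k l *
    (pd i (fun y => g y j l) x + pd j (fun y => g y i l) x - pd l (fun y => g y i j) x)

/-- The curvature tensor of type (1,3): `R(∂ᵢ, ∂ⱼ) ∂ₖ = ∑ₗ curvature g l k i j x • ∂ₗ`, where
`R(X, Y) = ∇_X ∇_Y - ∇_Y ∇_X - ∇_[X, Y]`. -/
noncomputable def curvature (g : (Fin 4 → ℝ) → Matrix (Fin 4) (Fin 4) ℝ)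
    (l k i j : Fin 4) (x : Fin 4 → ℝ) : ℝ :=
  pd i (christoffel g l j k) x - pd j (christoffel g l i k) x
    + ∑ m, (christoffel g l i m x * christoffel g m j k x
      - christoffel g l j m x * christoffel g m i k x)

/-- The Riemann tensor `Rᵢⱼₖₗ = g(R(∂ᵢ, ∂ⱼ) ∂ₗ, ∂ₖ)`
(so that `R₁₂₁₂ > 0` on a round sphere). -/
noncomputable def riemann (g : (Fin 4 → ℝ) → Matrix (Fin 4) (Fin 4) ℝ) (x : Fin 4 → ℝ)
    (i j k l : Fin 4) : ℝ :=
  ∑ m, g x k m * curvature g m l i j x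

/-- The Ricci tensor `Ric(∂ⱼ, ∂ₖ) = trace (X ↦ R(X, ∂ⱼ) ∂ₖ)`. -/
noncomputable def ricci (g : (Fin 4 → ℝ) → Matrix (Fin 4) (Fin 4) ℝ) (x : Fin 4 → ℝ)
    (j k : Fin 4) : ℝ :=
  ∑ i, curvature g i k i j x

/-- The scalar curvature. -/
noncomputable def scalarCurv (g : (Fin 4 → ℝ) → Matrix (Fin 4) (Fin 4) ℝ)
    (x : Fin 4 → ℝ) : ℝ :=
  ∑ j, ∑ k, (g x)⁻¹ j k * ricci g x j k

/-- The Weyl tensor `Wᵢⱼₖₗ` in dimension four. -/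
noncomputable def weyl (g : (Fin 4 → ℝ) → Matrix (Fin 4) (Fin 4) ℝ) (x : Fin 4 → ℝ)
    (i j k l : Fin 4) : ℝ :=
  riemann g x i j k l
    - (1 / 2) * (g x i k * ricci g x j l - g x i l * ricci g x j k
      + g x j l * ricci g x i k - g x j k * ricci g x i l)
    + (scalarCurv g x / 6) * (g x i k * g x j l - g x i l * g x j k)

/-- Components `T(e_a, e_b, e_c, e_d)` of a covariant 4-tensor in the frame
`e_a = ∑ᵢ E a i • ∂ᵢ`. -/
def frameComp (E : Fin 4 → Fin 4 → ℝ) (T : Fin 4 → Fin 4 → Fin 4 → Fin 4 → ℝ)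
    (a b c d : Fin 4) : ℝ :=
  ∑ i, ∑ j, ∑ k, ∑ l, E a i * E b j * E c k * E d l * T i j k l

/-! ### Two-forms in an oriented orthonormal frame

A two-form at a point is given by the antisymmetric matrix of its components in an orthonormal
frame `e₁, e₂, e₃, e₄`, which is indexed by `0, 1, 2, 3 : Fin 4`. -/

/-- The two-form `eᵃ ∧ eᵇ`. -/
def wedgeBasis (a b : Fin 4) : Matrix (Fin 4) (Fin 4) ℝ :=
  Matrix.single a b 1 - Matrix.single b a 1

/-- The basis `e¹∧e² + e³∧e⁴, e¹∧e³ + e⁴∧e², e¹∧e⁴ + e²∧e³` of the self-dual two-forms for the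
orientation `e¹∧e²∧e³∧e⁴`. -/
def selfDualBasis : Fin 3 → Matrix (Fin 4) (Fin 4) ℝ :=
  ![wedgeBasis 0 1 + wedgeBasis 2 3,
    wedgeBasis 0 2 + wedgeBasis 3 1,
    wedgeBasis 0 3 + wedgeBasis 1 2]

/-- The inner product of two-forms for which the `eᵃ ∧ eᵇ`, `a < b`, are orthonormal. -/
noncomputable def formInner (F G : Matrix (Fin 4) (Fin 4) ℝ) : ℝ :=
  (1 / 2) * ∑ a, ∑ b, F a b * G a b

/-- The operator on two-forms defined by a curvature-like tensor `T` (frame components):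
`eᶜ ∧ eᵈ ↦ (1/2) ∑ T_{abcd} eᵃ ∧ eᵇ`. -/
noncomputable def formOperator (T : Fin 4 → Fin 4 → Fin 4 → Fin 4 → ℝ)
    (F : Matrix (Fin 4) (Fin 4) ℝ) : Matrix (Fin 4) (Fin 4) ℝ :=
  Matrix.of fun a b => (1 / 2) * ∑ c, ∑ d, T a b c d * F c d

/-- The `Λ²₊ → Λ²₊` block of `formOperator T`, as a matrix in the basis `selfDualBasis`
(an orthogonal basis of forms of square norm two). -/
noncomputable def selfDualBlock (T : Fin 4 → Fin 4 → Fin 4 → Fin 4 → ℝ) :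
    Matrix (Fin 3) (Fin 3) ℝ :=
  Matrix.of fun p q => (1 / 2) * formInner (selfDualBasis p) (formOperator T (selfDualBasis q))

/-- `|A|`, the square root of the sum of the squares of the eigenvalues of `A`,
counted with multiplicity. -/
noncomputable def eigenNorm (A : Matrix (Fin 3) (Fin 3) ℝ) : ℝ :=
  Real.sqrt ((A.charpoly.roots.map fun μ => μ ^ 2).sum)

/-! ### Exterior calculus and the Lee form -/

/-- Components `(dω)ᵢⱼₖ` of the exterior derivative of the two-form `½ ∑ ωᵢⱼ dxⁱ ∧ dxʲ`. -/
noncomputable def extDer (ω : (Fin 4 → ℝ) → Matrix (Fin 4) (Fin 4) ℝ) (x : Fin 4 → ℝ)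
    (i j k : Fin 4) : ℝ :=
  pd i (fun y => ω y j k) x + pd j (fun y => ω y k i) x + pd k (fun y => ω y i j) x

/-- Components `(ξ ∧ F)ᵢⱼₖ` of the product of a one-form and a two-form at a point. -/
def wedgeOneTwo (ξ : Fin 4 → ℝ) (F : Matrix (Fin 4) (Fin 4) ℝ) (i j k : Fin 4) : ℝ :=
  ξ i * F j k + ξ j * F k i + ξ k * F i j

/-- The covector `∑ ξᵢ dxⁱ` as a continuous linear functional. -/
noncomputable def covector (ξ : Fin 4 → ℝ) : (Fin 4 → ℝ) →L[ℝ] ℝ :=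
  ∑ i, ξ i • ContinuousLinearMap.proj (R := ℝ) (φ := fun _ : Fin 4 => ℝ) i

/-- `covDerivEnd g J a b c x` is the component `∇_a J_b^c` of the covariant derivative of an
endomorphism field with components `J x b c = J_b^c`, that is, `J ∂_b = ∑ J_b^c ∂_c`. -/
noncomputable def covDerivEnd (g J : (Fin 4 → ℝ) → Matrix (Fin 4) (Fin 4) ℝ)
    (a b c : Fin 4) (x : Fin 4 → ℝ) : ℝ :=
  pd a (fun y => J y b c) x
    + ∑ m, (christoffel g c a m x * J x b m - christoffel g m a b x * J x m c)

/-- The Lee form of the almost Hermitian structure `(g, J)` in real dimension four: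
`ξᵢ = -∑ (∇_a J_b^a) J_i^b`. -/
noncomputable def leeForm (g J : (Fin 4 → ℝ) → Matrix (Fin 4) (Fin 4) ℝ)
    (x : Fin 4 → ℝ) (i : Fin 4) : ℝ :=
  -∑ b, (∑ a, covDerivEnd g J a b a x) * J x i b

/-! ### The Euclidean Kerr space

The coordinates are `(t, r, θ, φ) = (x 0, x 1, x 2, x 3)`. -/

/-- `Δ = r² - 2 M r - α²`. -/
def kerrDelta (M α : ℝ) (x : Fin 4 → ℝ) : ℝ := x 1 ^ 2 - 2 * M * x 1 - α ^ 2

/-- `Ξ = r² - α² cos² θ`. -/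
noncomputable def kerrXi (α : ℝ) (x : Fin 4 → ℝ) : ℝ := x 1 ^ 2 - α ^ 2 * Real.cos (x 2) ^ 2

/-- The coordinate domain on which the Euclidean Kerr metric is Riemannian. It contains the
exterior region `r > M + √(M² + α²)`, `0 < θ < π`. -/
def kerrDomain (M α : ℝ) : Set (Fin 4 → ℝ) :=
  {x | 0 < kerrDelta M α x ∧ 0 < kerrXi α x ∧ 0 < x 2 ∧ x 2 < Real.pi}

/-- The one-form `dt - α sin² θ dφ`. -/
noncomputable def kerrTau (α : ℝ) (x : Fin 4 → ℝ) : Fin 4 → ℝ :=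
  ![1, 0, 0, -(α * Real.sin (x 2) ^ 2)]

/-- The one-form `α dt + (r² - α²) dφ`. -/
def kerrEta (α : ℝ) (x : Fin 4 → ℝ) : Fin 4 → ℝ :=
  ![α, 0, 0, x 1 ^ 2 - α ^ 2]

/-- The one-form `dr`. -/
def kerrDr : Fin 4 → ℝ := ![0, 1, 0, 0]

/-- The one-form `dθ`. -/
def kerrDtheta : Fin 4 → ℝ := ![0, 0, 1, 0]

/-- The Euclidean Kerr metric
`Ξ (dr²/Δ + dθ²) + (sin² θ/Ξ) (α dt + (r² - α²) dφ)² + (Δ/Ξ) (dt - α sin² θ dφ)²`. -/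
noncomputable def kerrMetric (M α : ℝ) (x : Fin 4 → ℝ) : Matrix (Fin 4) (Fin 4) ℝ :=
  Matrix.of fun i j =>
    kerrXi α x * (kerrDr i * kerrDr j / kerrDelta M α x + kerrDtheta i * kerrDtheta j)
    + Real.sin (x 2) ^ 2 / kerrXi α x * (kerrEta α x i * kerrEta α x j)
    + kerrDelta M α x / kerrXi α x * (kerrTau α x i * kerrTau α x j)

/-- The oriented orthonormal coframe `e¹, e², e³, e⁴`. -/
noncomputable def kerrCoframe (M α : ℝ) (x : Fin 4 → ℝ) : Fin 4 → Fin 4 → ℝ :=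
  ![Real.sqrt (kerrXi α x / kerrDelta M α x) • kerrDr,
    Real.sqrt (kerrXi α x) • kerrDtheta,
    (Real.sin (x 2) / Real.sqrt (kerrXi α x)) • kerrEta α x,
    Real.sqrt (kerrDelta M α x / kerrXi α x) • kerrTau α x]

/-- The dual frame of vector fields `e₁, e₂, e₃, e₄`. -/
noncomputable def kerrFrame (M α : ℝ) (x : Fin 4 → ℝ) : Fin 4 → Fin 4 → ℝ :=
  ![Real.sqrt (kerrDelta M α x / kerrXi α x) • ![0, 1, 0, 0],
    (1 / Real.sqrt (kerrXi α x)) • ![0, 0, 1, 0],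
    (1 / (Real.sin (x 2) * Real.sqrt (kerrXi α x))) • ![α * Real.sin (x 2) ^ 2, 0, 0, 1],
    (1 / Real.sqrt (kerrDelta M α x * kerrXi α x)) • ![x 1 ^ 2 - α ^ 2, 0, 0, -α]]

/-- The metric is the sum of the squares of the coframe. -/
theorem kerrMetric_eq_coframe (M α : ℝ) {x : Fin 4 → ℝ} (hx : x ∈ kerrDomain M α)
    (i j : Fin 4) :
    kerrMetric M α x i j = ∑ a, kerrCoframe M α x a i * kerrCoframe M α x a j := by
  obtain ⟨hD, hX, -, -⟩ := hx
  have h1 := Real.mul_self_sqrt (div_pos hX hD).le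
  have h2 := Real.mul_self_sqrt hX.le
  have h3 := Real.mul_self_sqrt (div_pos hD hX).le
  have h4 : Real.sin (x 2) / Real.sqrt (kerrXi α x) * (Real.sin (x 2) / Real.sqrt (kerrXi α x))
      = Real.sin (x 2) ^ 2 / kerrXi α x := by
    rw [div_mul_div_comm, h2, sq]
  simp only [kerrMetric, Matrix.of_apply, Fin.sum_univ_four, kerrCoframe, Matrix.cons_val,
    Pi.smul_apply, smul_eq_mul]
  linear_combination (-(kerrDr i * kerrDr j)) * h1 - (kerrDtheta i * kerrDtheta j) * h2
    - (kerrTau α x i * kerrTau α x j) * h3 - (kerrEta α x i * kerrEta α x j) * h4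

/-- The frame is dual to the coframe. -/
theorem kerrCoframe_frame (M α : ℝ) {x : Fin 4 → ℝ} (hx : x ∈ kerrDomain M α)
    (a b : Fin 4) :
    ∑ i, kerrCoframe M α x a i * kerrFrame M α x b i = if a = b then 1 else 0 := by
  obtain ⟨hD, hX, h0, hpi⟩ := hx
  have hs : Real.sin (x 2) ≠ 0 := (Real.sin_pos_of_pos_of_lt_pi h0 hpi).ne'
  have hqX : Real.sqrt (kerrXi α x) ≠ 0 := (Real.sqrt_pos.2 hX).ne'
  have hqD : Real.sqrt (kerrDelta M α x) ≠ 0 := (Real.sqrt_pos.2 hD).ne'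
  have h2 : Real.sqrt (kerrXi α x) ^ 2 = x 1 ^ 2 - α ^ 2 * Real.cos (x 2) ^ 2 :=
    Real.sq_sqrt hX.le
  have h3 := Real.sin_sq_add_cos_sq (x 2)
  fin_cases a <;> fin_cases b <;>
    simp [Fin.sum_univ_four, kerrCoframe, kerrFrame, kerrDr, kerrDtheta, kerrEta, kerrTau,
      Real.sqrt_div hX.le, Real.sqrt_div hD.le, Real.sqrt_mul hD.le] <;>
    field_simp <;> first
      | done
      | ring1
      | (rw [h2]; linear_combination (-α ^ 2) * h3)
      | (rw [h2]; linear_combination (α ^ 2) * h3)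

/-- The almost complex structure `J e₁ = e₄`, `J e₂ = e₃`, `J e₃ = -e₂`, `J e₄ = -e₁`, as the
matrix `kerrJframe a b` of components `J e_a = ∑ kerrJframe a b • e_b`. -/
def kerrJframe : Matrix (Fin 4) (Fin 4) ℝ :=
  !![0, 0, 0, 1; 0, 0, 1, 0; 0, -1, 0, 0; -1, 0, 0, 0]

/-- Coordinate components of the almost complex structure, `J ∂ᵢ = ∑ (kerrJ M α x i j) • ∂ⱼ`. -/
noncomputable def kerrJ (M α : ℝ) (x : Fin 4 → ℝ) : Matrix (Fin 4) (Fin 4) ℝ :=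
  Matrix.of fun i j =>
    ∑ a, ∑ b, kerrCoframe M α x a i * kerrJframe a b * kerrFrame M α x b j

/-- Coordinate components of the fundamental two-form `ω(X, Y) = g(JX, Y)`. -/
noncomputable def kerrOmega (M α : ℝ) (x : Fin 4 → ℝ) : Matrix (Fin 4) (Fin 4) ℝ :=
  Matrix.of fun i j => ∑ k, kerrJ M α x i k * kerrMetric M α x k j

/-- The matrix `A` of the `Λ²₊` block of the Riemann curvature operator of the Euclidean Kerr
metric. -/
noncomputable def kerrA (M α : ℝ) (x : Fin 4 → ℝ) : Matrix (Fin 3) (Fin 3) ℝ :=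
  selfDualBlock (frameComp (kerrFrame M α x) (riemann (kerrMetric M α) x))

/-- The matrix of the self-dual Weyl operator `W⁺` of the Euclidean Kerr metric. -/
noncomputable def kerrWPlus (M α : ℝ) (x : Fin 4 → ℝ) : Matrix (Fin 3) (Fin 3) ℝ :=
  selfDualBlock (frameComp (kerrFrame M α x) (weyl (kerrMetric M α) x))

/-- The function `r - α cos θ`. -/
noncomputable def kerrRho (α : ℝ) (x : Fin 4 → ℝ) : ℝ := x 1 - α * Real.cos (x 2)

/-! The computation uses Cartan's moving frame method with an orthogonal but not normalised frame:
`∂_r`, `∂_θ`, `α sin² θ ∂_t + ∂_φ`, `(r² - α²) ∂_t - α ∂_φ`. Its components, its dual coframe and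
its squared lengths `Ξ/Δ`, `Ξ`, `Ξ sin² θ`, `ΔΞ` are rational in `r`, `cos θ`, `sin θ`, so no square
root is ever differentiated.

The connection matrices `Kerr.w` are written down explicitly. Metric compatibility and vanishing
torsion (`Kerr.metric_compat`, `Kerr.torsion`) characterise the Levi-Civita connection, so
`MovingFrame.christoffel_eq` identifies them with the Christoffel symbols. The curvature is then `dw
+ w ∧ w`, conjugated by the frame (`MovingFrame.curvature_eq`).

After normalisation the curvature is an algebraic tensor of type D (`Kerr.frameComp_riemann`): its
operator has eigenvalues `p, p, -2p` on self-dual and `q, q, -2q` on anti-self-dual forms. Such a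
tensor has zero Ricci contraction because `1 + 1 - 2 = 0`. Hence the Weyl and Riemann tensors
coincide, and the self-dual block is read off from `p`. The factorisation `Ξ = (r - α cos θ)(r + α
cos θ)` gives `p = -M/(r - α cos θ)³` (`Kerr.mu_add_nu`), and the norm follows from `p² + p² + 4p² =
6p²`.

For the Lee form, the divergence of `J` is computed in the same frame (`Kerr.divergence_Jf`). In `ω`
all denominators cancel, so `dω = ξ ∧ ω` is checked by direct differentiation; nondegeneracy of `ω`
makes `ξ` unique (`Kerr.eq_of_wedge_eq`). Since `ξ` is the differential of `log (r - α cos θ)²`, any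
other potential on a connected open set differs from this one by a constant, which becomes a
positive factor after exponentiation. -/

/-! ### Partial derivatives -/

/-- `f` has the partial derivative `f'` in the direction `i` at `x`. -/
def HasPd (i : Fin 4) (f : (Fin 4 → ℝ) → ℝ) (f' : ℝ) (x : Fin 4 → ℝ) : Prop :=
  HasDerivAt (fun s => f (Function.update x i s)) f' (x i)

theorem HasPd.pd_eq {i : Fin 4} {f : (Fin 4 → ℝ) → ℝ} {f' : ℝ} {x : Fin 4 → ℝ}
    (h : HasPd i f f' x) : pd i f x = f' :=
  h.deriv

/-- Frame formulas hold only on the chart domain; openness keeps nearby points of a coordinate line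
inside it, so formulas that agree there may be differentiated in place of one another. -/
theorem HasPd.congr {i : Fin 4} {f f₁ : (Fin 4 → ℝ) → ℝ} {f' : ℝ} {x : Fin 4 → ℝ}
    {U : Set (Fin 4 → ℝ)} (h : HasPd i f f' x) (hU : IsOpen U) (hx : x ∈ U)
    (hf : ∀ y ∈ U, f₁ y = f y) : HasPd i f₁ f' x := by
  have hc : Continuous fun s : ℝ => Function.update x i s := by fun_prop
  refine HasDerivAt.congr_of_eventuallyEq h ?_
  have : ∀ᶠ s in nhds (x i), Function.update x i s ∈ U :=
    hc.continuousAt.eventually_mem (hU.mem_nhds (by simpa using hx))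
  filter_upwards [this] with s hs using hf _ hs

theorem HasPd.add {i : Fin 4} {f g : (Fin 4 → ℝ) → ℝ} {f' g' : ℝ} {x : Fin 4 → ℝ}
    (hf : HasPd i f f' x) (hg : HasPd i g g' x) :
    HasPd i (fun y => f y + g y) (f' + g') x :=
  HasDerivAt.add hf hg

theorem HasPd.sub {i : Fin 4} {f g : (Fin 4 → ℝ) → ℝ} {f' g' : ℝ} {x : Fin 4 → ℝ}
    (hf : HasPd i f f' x) (hg : HasPd i g g' x) :
    HasPd i (fun y => f y - g y) (f' - g') x :=
  HasDerivAt.sub hf hg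

theorem HasPd.mul {i : Fin 4} {f g : (Fin 4 → ℝ) → ℝ} {f' g' : ℝ} {x : Fin 4 → ℝ}
    (hf : HasPd i f f' x) (hg : HasPd i g g' x) :
    HasPd i (fun y => f y * g y) (f' * g x + f x * g') x := by
  have := HasDerivAt.fun_mul hf hg
  simp only [Function.update_eq_self] at this
  exact this

theorem HasPd.inv {i : Fin 4} {f : (Fin 4 → ℝ) → ℝ} {f' : ℝ} {x : Fin 4 → ℝ}
    (hf : HasPd i f f' x) (h0 : f x ≠ 0) :
    HasPd i (fun y => (f y)⁻¹) (-f' / f x ^ 2) x := by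
  have := HasDerivAt.fun_inv hf (by simpa only [Function.update_eq_self] using h0)
  simp only [Function.update_eq_self] at this
  exact this

theorem hasPd_const (i : Fin 4) (c : ℝ) (x : Fin 4 → ℝ) : HasPd i (fun _ => c) 0 x :=
  hasDerivAt_const _ _

theorem HasPd.sum {ι : Type*} {s : Finset ι} {i : Fin 4} {f : ι → (Fin 4 → ℝ) → ℝ}
    {f' : ι → ℝ} {x : Fin 4 → ℝ} (h : ∀ k ∈ s, HasPd i (f k) (f' k) x) :
    HasPd i (fun y => ∑ k ∈ s, f k y) (∑ k ∈ s, f' k) x :=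
  HasDerivAt.fun_sum h

theorem hasPd_coord (i j : Fin 4) (x : Fin 4 → ℝ) :
    HasPd i (fun y => y j) (if i = j then 1 else 0) x := by
  unfold HasPd
  rcases eq_or_ne i j with rfl | h
  · simpa using hasDerivAt_id' (x i)
  · simpa [Function.update_of_ne h.symm, h] using hasDerivAt_const (x i) (x j)

theorem HasPd.comp {i : Fin 4} {f : (Fin 4 → ℝ) → ℝ} {f' : ℝ} {x : Fin 4 → ℝ}
    {φ : ℝ → ℝ} {φ' : ℝ} (hφ : HasDerivAt φ φ' (f x)) (hf : HasPd i f f' x) :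
    HasPd i (fun y => φ (f y)) (φ' * f') x := by
  unfold HasPd at hf ⊢
  refine HasDerivAt.comp (x i) ?_ hf
  simpa only [Function.update_eq_self] using hφ

/-- The matrix-valued function `A` has the partial derivative `A'`, entry by entry. -/
def HasPdM (i : Fin 4) (A : (Fin 4 → ℝ) → Matrix (Fin 4) (Fin 4) ℝ)
    (A' : Matrix (Fin 4) (Fin 4) ℝ) (x : Fin 4 → ℝ) : Prop :=
  ∀ a b, HasPd i (fun y => A y a b) (A' a b) x

theorem HasPdM.mul {i : Fin 4} {A B : (Fin 4 → ℝ) → Matrix (Fin 4) (Fin 4) ℝ}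
    {A' B' : Matrix (Fin 4) (Fin 4) ℝ} {x : Fin 4 → ℝ}
    (hA : HasPdM i A A' x) (hB : HasPdM i B B' x) :
    HasPdM i (fun y => A y * B y) (A' * B x + A x * B') x := by
  intro a b
  simp only [Matrix.mul_apply, Matrix.add_apply, ← Finset.sum_add_distrib]
  exact HasPd.sum fun k _ => (hA a k).mul (hB k b)

theorem HasPdM.sub {i : Fin 4} {A B : (Fin 4 → ℝ) → Matrix (Fin 4) (Fin 4) ℝ}
    {A' B' : Matrix (Fin 4) (Fin 4) ℝ} {x : Fin 4 → ℝ}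
    (hA : HasPdM i A A' x) (hB : HasPdM i B B' x) :
    HasPdM i (fun y => A y - B y) (A' - B') x :=
  fun a b => (hA a b).sub (hB a b)

theorem HasPdM.transpose {i : Fin 4} {A : (Fin 4 → ℝ) → Matrix (Fin 4) (Fin 4) ℝ}
    {A' : Matrix (Fin 4) (Fin 4) ℝ} {x : Fin 4 → ℝ} (hA : HasPdM i A A' x) :
    HasPdM i (fun y => (A y).transpose) A'.transpose x :=
  fun a b => hA b a

theorem HasPdM.congr {i : Fin 4} {A A₁ : (Fin 4 → ℝ) → Matrix (Fin 4) (Fin 4) ℝ}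
    {A' : Matrix (Fin 4) (Fin 4) ℝ} {x : Fin 4 → ℝ} {U : Set (Fin 4 → ℝ)}
    (h : HasPdM i A A' x) (hU : IsOpen U) (hx : x ∈ U) (hA : ∀ y ∈ U, A₁ y = A y) :
    HasPdM i A₁ A' x :=
  fun a b => (h a b).congr hU hx fun y hy => by rw [hA y hy]

theorem HasPdM.unique {i : Fin 4} {A : (Fin 4 → ℝ) → Matrix (Fin 4) (Fin 4) ℝ}
    {A' A'' : Matrix (Fin 4) (Fin 4) ℝ} {x : Fin 4 → ℝ}
    (h : HasPdM i A A' x) (h' : HasPdM i A A'' x) : A' = A'' := by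
  ext a b
  rw [← (h a b).pd_eq, (h' a b).pd_eq]

theorem hasPdM_const (i : Fin 4) (A : Matrix (Fin 4) (Fin 4) ℝ) (x : Fin 4 → ℝ) :
    HasPdM i (fun _ => A) 0 x :=
  fun _ _ => hasPd_const _ _ _

/-! ### The Levi-Civita connection in a moving frame -/

/-- A torsion-free metric connection is given by the Christoffel symbols. -/
theorem christoffel_eq_of_metric_of_symm {g : (Fin 4 → ℝ) → Matrix (Fin 4) (Fin 4) ℝ}
    {x : Fin 4 → ℝ} {G : Fin 4 → Matrix (Fin 4) (Fin 4) ℝ}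
    (hinv : (g x)⁻¹ * g x = 1)
    (hG : ∀ i j k, G i k j = G j k i)
    (hg : ∀ i, HasPdM i g (g x * G i + (g x * G i).transpose) x) (k i j : Fin 4) :
    christoffel g k i j x = G i k j := by
  have hpd : ∀ i a b, pd i (fun y => g y a b) x
      = ∑ m, (g x a m * G i m b + g x b m * G i m a) := fun i a b => by
    rw [(hg i a b).pd_eq, Matrix.add_apply, Matrix.transpose_apply, Matrix.mul_apply,
      Matrix.mul_apply, Finset.sum_add_distrib]
  -- Koszul's argument: of the six terms given by metric compatibility, four cancel in pairs by the
  -- symmetry `hG`, and the other two are equal.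
  have key : ∀ l, pd i (fun y => g y j l) x + pd j (fun y => g y i l) x
      - pd l (fun y => g y i j) x = 2 * (g x * G i) l j := fun l => by
    rw [hpd, hpd, hpd, Matrix.mul_apply, Finset.mul_sum, ← Finset.sum_add_distrib,
      ← Finset.sum_sub_distrib]
    refine Finset.sum_congr rfl fun m _ => ?_
    rw [hG i l m, hG j l m, hG j i m]
    ring
  have : ((g x)⁻¹ * (g x * G i)) k j = G i k j := by
    rw [← mul_assoc, hinv, one_mul]
  rw [christoffel, ← this, Matrix.mul_apply, Finset.mul_sum]
  refine Finset.sum_congr rfl fun l _ => ?_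
  rw [key]
  ring

/-- A frame `E_a = ∑ E k a ∂_k` on `U` that is orthogonal for `g`, with dual coframe `e`, squared
lengths `h` and the matrices `w i a b` of its Levi-Civita connection,
`∇_i E_b = ∑ w i a b E_a`. The partial derivatives of `E`, `e`, `h`, `w` are part of the data. -/
structure MovingFrame (U : Set (Fin 4 → ℝ)) (g : (Fin 4 → ℝ) → Matrix (Fin 4) (Fin 4) ℝ) where
  E : (Fin 4 → ℝ) → Matrix (Fin 4) (Fin 4) ℝ
  e : (Fin 4 → ℝ) → Matrix (Fin 4) (Fin 4) ℝ
  h : (Fin 4 → ℝ) → Fin 4 → ℝ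
  w : Fin 4 → (Fin 4 → ℝ) → Matrix (Fin 4) (Fin 4) ℝ
  dE : Fin 4 → (Fin 4 → ℝ) → Matrix (Fin 4) (Fin 4) ℝ
  de : Fin 4 → (Fin 4 → ℝ) → Matrix (Fin 4) (Fin 4) ℝ
  dh : Fin 4 → (Fin 4 → ℝ) → Fin 4 → ℝ
  dw : Fin 4 → Fin 4 → (Fin 4 → ℝ) → Matrix (Fin 4) (Fin 4) ℝ
  ddE : Fin 4 → Fin 4 → (Fin 4 → ℝ) → Matrix (Fin 4) (Fin 4) ℝ
  isOpen : IsOpen U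
  mul_eq_one : ∀ x ∈ U, e x * E x = 1
  metric_eq : ∀ x ∈ U, g x = (e x).transpose * Matrix.diagonal (h x) * e x
  h_ne_zero : ∀ x ∈ U, ∀ a, h x a ≠ 0
  hasPd_E : ∀ x ∈ U, ∀ i, HasPdM i E (dE i x) x
  hasPd_e : ∀ x ∈ U, ∀ i, HasPdM i e (de i x) x
  hasPd_h : ∀ x ∈ U, ∀ i a, HasPd i (fun y => h y a) (dh i x a) x
  hasPd_w : ∀ x ∈ U, ∀ i j, HasPdM i (w j) (dw i j x) x
  hasPd_dE : ∀ x ∈ U, ∀ i j, HasPdM i (dE j) (ddE i j x) x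
  ddE_comm : ∀ x ∈ U, ∀ i j, ddE i j x = ddE j i x
  metric : ∀ x ∈ U, ∀ i, Matrix.diagonal (dh i x)
    = Matrix.diagonal (h x) * w i x + (Matrix.diagonal (h x) * w i x).transpose
  torsion : ∀ x ∈ U, ∀ i j a, (de i x + w i x * e x) a j = (de j x + w j x * e x) a i

namespace MovingFrame

variable {U : Set (Fin 4 → ℝ)} {g : (Fin 4 → ℝ) → Matrix (Fin 4) (Fin 4) ℝ}
  (F : MovingFrame U g) {x : Fin 4 → ℝ}

theorem mul_eq_one' (hx : x ∈ U) : F.E x * F.e x = 1 :=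
  mul_eq_one_comm.1 (F.mul_eq_one x hx)

/-- The inverse metric is `E h⁻¹ Eᵀ`, since `g = eᵀ h e` and `e E = 1`. -/
theorem inv_mul_metric (F : MovingFrame U g) {x : Fin 4 → ℝ} (hx : x ∈ U) : (g x)⁻¹ * g x = 1 := by
  have hd : Matrix.diagonal (fun a => (F.h x a)⁻¹) * Matrix.diagonal (F.h x) = 1 := by
    rw [Matrix.diagonal_mul_diagonal, ← Matrix.diagonal_one]
    congr 1
    ext a
    exact inv_mul_cancel₀ (F.h_ne_zero x hx a)
  have hT : (F.E x).transpose * (F.e x).transpose = 1 := by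
    rw [← Matrix.transpose_mul, F.mul_eq_one x hx, Matrix.transpose_one]
  have : (F.E x * Matrix.diagonal (fun a => (F.h x a)⁻¹) * (F.E x).transpose) * g x = 1 := by
    calc (F.E x * Matrix.diagonal (fun a => (F.h x a)⁻¹) * (F.E x).transpose) * g x
        = F.E x * (Matrix.diagonal (fun a => (F.h x a)⁻¹)
          * ((F.E x).transpose * (F.e x).transpose) * Matrix.diagonal (F.h x)) * F.e x := by
          rw [F.metric_eq x hx]
          simp only [mul_assoc]
      _ = 1 := by rw [hT, mul_one, hd, mul_one, F.mul_eq_one' hx]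
  rw [Matrix.inv_eq_left_inv this, this]

/-- Differentiate `e E = 1`, which holds on the open set `U`. -/
theorem de_eq (hx : x ∈ U) (i : Fin 4) : F.de i x = -(F.e x * F.dE i x * F.e x) := by
  have h1 := (F.hasPd_e x hx i).mul (F.hasPd_E x hx i)
  have h2 : F.de i x * F.E x + F.e x * F.dE i x = 0 :=
    (h1.congr F.isOpen hx (fun y hy => (F.mul_eq_one y hy).symm)).unique (hasPdM_const i 1 x)
  calc F.de i x = F.de i x * (F.E x * F.e x) := by rw [F.mul_eq_one' hx, mul_one]
    _ = (F.de i x * F.E x + F.e x * F.dE i x) * F.e x - F.e x * F.dE i x * F.e x := by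
      noncomm_ring
    _ = -(F.e x * F.dE i x * F.e x) := by rw [h2]; noncomm_ring

/-- The matrix of the connection in the coordinate frame. -/
def coordConn (i : Fin 4) (x : Fin 4 → ℝ) : Matrix (Fin 4) (Fin 4) ℝ :=
  (F.E x * F.w i x - F.dE i x) * F.e x

theorem coordConn_eq (hx : x ∈ U) (i : Fin 4) :
    F.coordConn i x = F.E x * (F.de i x + F.w i x * F.e x) := by
  rw [coordConn, F.de_eq hx]
  calc (F.E x * F.w i x - F.dE i x) * F.e x
      = F.E x * F.w i x * F.e x - 1 * F.dE i x * F.e x := by noncomm_ring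
    _ = _ := by rw [← F.mul_eq_one' hx]; noncomm_ring

/-- Leibniz on `g = eᵀ h e`: inserting `dh = hw + (hw)ᵀ` splits the derivative into a matrix and its
transpose. -/
theorem hasPd_metric (hx : x ∈ U) (i : Fin 4) :
    HasPdM i g (g x * F.coordConn i x + (g x * F.coordConn i x).transpose) x := by
  have hd : HasPdM i (fun y => Matrix.diagonal (F.h y)) (Matrix.diagonal (F.dh i x)) x := by
    intro a b
    rcases eq_or_ne a b with rfl | hab
    · simpa using F.hasPd_h x hx i a
    · simpa [Matrix.diagonal_apply_ne _ hab] using hasPd_const i 0 x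
  have h1 := ((F.hasPd_e x hx i).transpose.mul hd).mul (F.hasPd_e x hx i)
  have h2 := h1.congr F.isOpen hx F.metric_eq
  convert h2 using 1
  have h3 : g x * F.coordConn i x = (F.e x).transpose * Matrix.diagonal (F.h x) * F.de i x
      + (F.e x).transpose * (Matrix.diagonal (F.h x) * F.w i x) * F.e x := by
    calc g x * F.coordConn i x = (F.e x).transpose * Matrix.diagonal (F.h x)
          * (F.e x * F.E x) * (F.de i x + F.w i x * F.e x) := by
          rw [F.coordConn_eq hx, F.metric_eq x hx]
          noncomm_ring
      _ = _ := by
        rw [F.mul_eq_one x hx]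
        noncomm_ring
  rw [h3, F.metric x hx i]
  simp only [Matrix.transpose_add, Matrix.transpose_mul, Matrix.transpose_transpose,
    Matrix.diagonal_transpose]
  noncomm_ring

/-- Up to multiplication by `E`, this is the torsion equation of the coframe. -/
theorem coordConn_symm (hx : x ∈ U) (i j k : Fin 4) :
    F.coordConn i x k j = F.coordConn j x k i := by
  rw [F.coordConn_eq hx, F.coordConn_eq hx, Matrix.mul_apply, Matrix.mul_apply]
  exact Finset.sum_congr rfl fun a _ => by rw [F.torsion x hx i j a]

theorem christoffel_eq (hx : x ∈ U) (k i j : Fin 4) :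
    christoffel g k i j x = F.coordConn i x k j :=
  christoffel_eq_of_metric_of_symm (G := fun i => F.coordConn i x) (F.inv_mul_metric hx)
    (fun i j k => F.coordConn_symm hx i j k) (F.hasPd_metric hx) k i j

theorem hasPd_coordConn (hx : x ∈ U) (i j : Fin 4) :
    HasPdM i (F.coordConn j)
      ((F.dE i x * F.w j x + F.E x * F.dw i j x - F.ddE i j x) * F.e x
        + (F.E x * F.w j x - F.dE j x) * F.de i x) x :=
  (((F.hasPd_E x hx i).mul (F.hasPd_w x hx i j)).sub (F.hasPd_dE x hx i j)).mul
    (F.hasPd_e x hx i)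

/-- The matrix of the curvature endomorphism `R(∂ᵢ, ∂ⱼ)` in the frame. -/
def curv (i j : Fin 4) (x : Fin 4 → ℝ) : Matrix (Fin 4) (Fin 4) ℝ :=
  F.dw i j x - F.dw j i x + (F.w i x * F.w j x - F.w j x * F.w i x)

/-- Gauge covariance of the curvature. The derivatives of `E` cancel against those of `e` through `e
E = 1`, and the second derivatives of `E` drop out by `ddE_comm`. -/
theorem curvature_eq (hx : x ∈ U) (l k i j : Fin 4) :
    curvature g l k i j x = (F.E x * F.curv i j x * F.e x) l k := by
  have hpd : ∀ i j, pd i (christoffel g l j k) x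
      = ((F.dE i x * F.w j x + F.E x * F.dw i j x - F.ddE i j x) * F.e x
        + (F.E x * F.w j x - F.dE j x) * F.de i x) l k := fun i j =>
    ((F.hasPd_coordConn hx i j l k).congr F.isOpen hx
      fun y hy => F.christoffel_eq hy l j k).pd_eq
  have hprod : ∀ i j, F.coordConn i x * F.coordConn j x
      = F.E x * (F.w i x * F.w j x) * F.e x - F.dE i x * F.w j x * F.e x
        + (F.E x * F.w i x - F.dE i x) * F.de j x := fun i j => by
    calc F.coordConn i x * F.coordConn j x
        = (F.E x * F.w i x - F.dE i x) * (F.e x * F.E x) * (F.de j x + F.w j x * F.e x) := by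
          rw [F.coordConn_eq hx j, coordConn]
          noncomm_ring
      _ = _ := by
        rw [F.mul_eq_one x hx]
        noncomm_ring
  have hsum : ∑ m, (christoffel g l i m x * christoffel g m j k x
      - christoffel g l j m x * christoffel g m i k x)
      = (F.coordConn i x * F.coordConn j x - F.coordConn j x * F.coordConn i x) l k := by
    simp only [F.christoffel_eq hx, Matrix.sub_apply, Matrix.mul_apply, Finset.sum_sub_distrib]
  rw [curvature, hpd, hpd, hsum, hprod, hprod, F.ddE_comm x hx i j, ← Matrix.sub_apply,
    ← Matrix.add_apply]
  refine congrArg (fun N : Matrix (Fin 4) (Fin 4) ℝ => N l k) ?_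
  rw [curv]
  noncomm_ring

/-- The covariant derivative of an endomorphism field with frame components `A` whose partial
derivative is `dA`. -/
theorem covDerivEnd_eq (hx : x ∈ U) {J : (Fin 4 → ℝ) → Matrix (Fin 4) (Fin 4) ℝ}
    {A : (Fin 4 → ℝ) → Matrix (Fin 4) (Fin 4) ℝ} {dA : Matrix (Fin 4) (Fin 4) ℝ} {i : Fin 4}
    (hJ : ∀ y ∈ U, (J y).transpose = F.E y * A y * F.e y) (hA : HasPdM i A dA x)
    (b c : Fin 4) :
    covDerivEnd g J i b c x
      = (F.E x * (dA + F.w i x * A x - A x * F.w i x) * F.e x) c b := by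
  have h1 := ((F.hasPd_E x hx i).mul hA).mul (F.hasPd_e x hx i)
  have h2 := (h1.congr F.isOpen hx hJ) c b
  have hsum : ∑ m, (christoffel g c i m x * J x b m - christoffel g m i b x * J x m c)
      = (F.coordConn i x * (J x).transpose - (J x).transpose * F.coordConn i x) c b := by
    simp only [F.christoffel_eq hx, Matrix.sub_apply, Matrix.mul_apply, Matrix.transpose_apply,
      Finset.sum_sub_distrib, mul_comm (J x _ c)]
  -- The transpose appears because `J x b c` has its lower index first, whereas matrices acting on
  -- columns have the upper index first.
  have hL : F.coordConn i x * (J x).transpose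
      = (F.E x * F.w i x - F.dE i x) * A x * F.e x := by
    calc F.coordConn i x * (J x).transpose
        = (F.E x * F.w i x - F.dE i x) * (F.e x * F.E x) * A x * F.e x := by
          rw [hJ x hx, coordConn]
          noncomm_ring
      _ = _ := by rw [F.mul_eq_one x hx, mul_one]
  have hR : (J x).transpose * F.coordConn i x
      = F.E x * A x * (F.de i x + F.w i x * F.e x) := by
    calc (J x).transpose * F.coordConn i x
        = F.E x * A x * (F.e x * F.E x) * (F.de i x + F.w i x * F.e x) := by
          rw [hJ x hx, F.coordConn_eq hx]
          noncomm_ring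
      _ = _ := by rw [F.mul_eq_one x hx, mul_one]
  have h3 : pd i (fun y => J y b c) x = _ := h2.pd_eq
  rw [covDerivEnd, h3, hsum, hL, hR, ← Matrix.add_apply]
  refine congrArg (fun N : Matrix (Fin 4) (Fin 4) ℝ => N c b) ?_
  noncomm_ring

end MovingFrame

/-! ### Functions with their partial derivatives -/

/-- A function on the chart together with its partial derivatives on `U`. -/
structure DiffFun (U : Set (Fin 4 → ℝ)) where
  val : (Fin 4 → ℝ) → ℝ
  d : Fin 4 → (Fin 4 → ℝ) → ℝ
  hasPd : ∀ x ∈ U, ∀ i, HasPd i val (d i x) x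

namespace DiffFun

variable {U : Set (Fin 4 → ℝ)}

/-- Constant functions. -/
def const (c : ℝ) : DiffFun U := ⟨fun _ => c, fun _ _ => 0, fun x _ i => hasPd_const i c x⟩

instance : Zero (DiffFun U) := ⟨const 0⟩

instance : One (DiffFun U) := ⟨const 1⟩

instance : Add (DiffFun U) :=
  ⟨fun f g => ⟨fun x => f.val x + g.val x, fun i x => f.d i x + g.d i x,
    fun x hx i => (f.hasPd x hx i).add (g.hasPd x hx i)⟩⟩

instance : Sub (DiffFun U) :=
  ⟨fun f g => ⟨fun x => f.val x - g.val x, fun i x => f.d i x - g.d i x,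
    fun x hx i => (f.hasPd x hx i).sub (g.hasPd x hx i)⟩⟩

instance : Mul (DiffFun U) :=
  ⟨fun f g => ⟨fun x => f.val x * g.val x, fun i x => f.d i x * g.val x + f.val x * g.d i x,
    fun x hx i => (f.hasPd x hx i).mul (g.hasPd x hx i)⟩⟩

instance : Neg (DiffFun U) := ⟨fun f => const (-1) * f⟩

instance : Pow (DiffFun U) ℕ :=
  ⟨fun f n => ⟨fun x => f.val x ^ n, fun i x => n * f.val x ^ (n - 1) * f.d i x,
    fun x hx i => (f.hasPd x hx i).comp (hasDerivAt_pow n (f.val x))⟩⟩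

instance : Coe ℝ (DiffFun U) := ⟨const⟩

/-- The inverse of a function without zeros. -/
noncomputable def inv (f : DiffFun U) (h : ∀ x ∈ U, f.val x ≠ 0) : DiffFun U :=
  ⟨fun x => (f.val x)⁻¹, fun i x => -f.d i x / f.val x ^ 2,
    fun x hx i => (f.hasPd x hx i).inv (h x hx)⟩

variable (f g : DiffFun U) (x : Fin 4 → ℝ) (i : Fin 4) (c : ℝ) (n : ℕ)

@[simp] theorem zero_val : (0 : DiffFun U).val x = 0 := rfl
@[simp] theorem zero_d : (0 : DiffFun U).d i x = 0 := rfl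
@[simp] theorem one_val : (1 : DiffFun U).val x = 1 := rfl
@[simp] theorem one_d : (1 : DiffFun U).d i x = 0 := rfl
@[simp] theorem const_val : (const c : DiffFun U).val x = c := rfl
@[simp] theorem const_d : (const c : DiffFun U).d i x = 0 := rfl
@[simp] theorem add_val : (f + g).val x = f.val x + g.val x := rfl
@[simp] theorem add_d : (f + g).d i x = f.d i x + g.d i x := rfl
@[simp] theorem sub_val : (f - g).val x = f.val x - g.val x := rfl
@[simp] theorem sub_d : (f - g).d i x = f.d i x - g.d i x := rfl
@[simp] theorem mul_val : (f * g).val x = f.val x * g.val x := rfl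
@[simp] theorem mul_d : (f * g).d i x = f.d i x * g.val x + f.val x * g.d i x := rfl
@[simp] theorem pow_val : (f ^ n).val x = f.val x ^ n := rfl
@[simp] theorem pow_d : (f ^ n).d i x = n * f.val x ^ (n - 1) * f.d i x := rfl

@[simp] theorem neg_val : (-f).val x = -f.val x :=
  (mul_val (const (-1)) f x).trans (neg_one_mul _)

@[simp] theorem neg_d : (-f).d i x = -f.d i x :=
  (mul_d (const (-1)) f x i).trans (by simp)

end DiffFun

/-! ### Kerr data -/

theorem isOpen_kerrDomain (M α : ℝ) : IsOpen (kerrDomain M α) := by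
  have h1 : Continuous (kerrDelta M α) := by unfold kerrDelta; fun_prop
  have h2 : Continuous (kerrXi α) := by unfold kerrXi; fun_prop
  exact (isOpen_lt continuous_const h1).inter ((isOpen_lt continuous_const h2).inter
    ((isOpen_lt continuous_const (continuous_apply 2)).inter
      (isOpen_lt (continuous_apply 2) continuous_const)))

namespace Kerr

variable (M α : ℝ)

/-- The differentiable functions on the Kerr domain. -/
abbrev Fun := DiffFun (kerrDomain M α)

/-- The coordinate `r`. -/
def r : Fun M α :=
  ⟨fun x => x 1, fun i _ => ![0, 1, 0, 0] i, fun x _ i => by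
    have := hasPd_coord i 1 x
    fin_cases i <;> simpa using this⟩

/-- `cos θ`. -/
noncomputable def c : Fun M α :=
  ⟨fun x => Real.cos (x 2), fun i x => ![0, 0, -Real.sin (x 2), 0] i, fun x _ i => by
    have := (hasPd_coord i 2 x).comp (Real.hasDerivAt_cos (x 2))
    fin_cases i <;> simpa using this⟩

/-- `sin θ`. -/
noncomputable def s : Fun M α :=
  ⟨fun x => Real.sin (x 2), fun i x => ![0, 0, Real.cos (x 2), 0] i, fun x _ i => by
    have := (hasPd_coord i 2 x).comp (Real.hasDerivAt_sin (x 2))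
    fin_cases i <;> simpa using this⟩

variable {M α} (x : Fin 4 → ℝ) (i : Fin 4)

@[simp] theorem r_val : (r M α).val x = x 1 := rfl
@[simp] theorem r_d : (r M α).d i x = ![0, 1, 0, 0] i := rfl
@[simp] theorem c_val : (c M α).val x = Real.cos (x 2) := rfl
@[simp] theorem c_d : (c M α).d i x = ![0, 0, -Real.sin (x 2), 0] i := rfl
@[simp] theorem s_val : (s M α).val x = Real.sin (x 2) := rfl
@[simp] theorem s_d : (s M α).d i x = ![0, 0, Real.cos (x 2), 0] i := rfl

variable (M α)

/-- `Ξ`. -/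
noncomputable def X : Fun M α :=
  ⟨kerrXi α, fun i x => ![0, 2 * x 1, 2 * α ^ 2 * Real.cos (x 2) * Real.sin (x 2), 0] i,
    fun x hx i => by
      have h := (r M α ^ 2 - (α ^ 2 : ℝ) * c M α ^ 2 : Fun M α).hasPd x hx i
      have hd : (r M α ^ 2 - (α ^ 2 : ℝ) * c M α ^ 2 : Fun M α).d i x
          = ![0, 2 * x 1, 2 * α ^ 2 * Real.cos (x 2) * Real.sin (x 2), 0] i := by
        fin_cases i <;> simp
        ring
      rwa [hd] at h⟩

/-- `Δ`. -/
def D : Fun M α :=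
  ⟨kerrDelta M α, fun i x => ![0, 2 * (x 1 - M), 0, 0] i, fun x hx i => by
    have h := (r M α ^ 2 - (2 * M : ℝ) * r M α - (α ^ 2 : ℝ) : Fun M α).hasPd x hx i
    have hd : (r M α ^ 2 - (2 * M : ℝ) * r M α - (α ^ 2 : ℝ) : Fun M α).d i x
        = ![0, 2 * (x 1 - M), 0, 0] i := by
      fin_cases i <;> simp
      ring
    rwa [hd] at h⟩

variable {M α}

@[simp] theorem X_val : (X M α).val x = kerrXi α x := rfl
@[simp] theorem X_d : (X M α).d i x
  = ![0, 2 * x 1, 2 * α ^ 2 * Real.cos (x 2) * Real.sin (x 2), 0] i := rfl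
@[simp] theorem D_val : (D M α).val x = kerrDelta M α x := rfl
@[simp] theorem D_d : (D M α).d i x = ![0, 2 * (x 1 - M), 0, 0] i := rfl

theorem sin_ne_zero {x : Fin 4 → ℝ} (hx : x ∈ kerrDomain M α) : Real.sin (x 2) ≠ 0 :=
  (Real.sin_pos_of_pos_of_lt_pi hx.2.2.1 hx.2.2.2).ne'

variable (M α)

/-- `1 / Ξ`. -/
noncomputable def Xi : Fun M α := (X M α).inv fun _ hx => hx.2.1.ne'

/-- `1 / Δ`. -/
noncomputable def Di : Fun M α := (D M α).inv fun _ hx => hx.1.ne'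

/-- `1 / sin θ`. -/
noncomputable def si : Fun M α := (s M α).inv fun _ hx => sin_ne_zero hx

variable {M α}

@[simp] theorem Xi_val : (Xi M α).val x = (kerrXi α x)⁻¹ := rfl
@[simp] theorem Xi_d : (Xi M α).d i x = -(X M α).d i x / kerrXi α x ^ 2 := rfl
@[simp] theorem Di_val : (Di M α).val x = (kerrDelta M α x)⁻¹ := rfl
@[simp] theorem Di_d : (Di M α).d i x = -(D M α).d i x / kerrDelta M α x ^ 2 := rfl
@[simp] theorem si_val : (si M α).val x = (Real.sin (x 2))⁻¹ := rfl
@[simp] theorem si_d : (si M α).d i x = -(s M α).d i x / Real.sin (x 2) ^ 2 := rfl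

variable (M α)

/-- The vector fields `∂_r`, `∂_θ`, `α sin² θ ∂_t + ∂_φ`, `(r² - α²) ∂_t - α ∂_φ` (as columns). -/
noncomputable def E : Matrix (Fin 4) (Fin 4) (Fun M α) :=
  !![0, 0, α * s M α ^ 2, r M α ^ 2 - (α ^ 2 : ℝ);
    1, 0, 0, 0;
    0, 1, 0, 0;
    0, 0, 1, (-α : ℝ)]

/-- The partial derivatives of `E`. -/
noncomputable def dE : Fin 4 → Matrix (Fin 4) (Fin 4) (Fun M α) :=
  ![!![0, 0, 0, 0; 0, 0, 0, 0; 0, 0, 0, 0; 0, 0, 0, 0],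
    !![0, 0, 0, (2 : ℝ) * r M α; 0, 0, 0, 0; 0, 0, 0, 0; 0, 0, 0, 0],
    !![0, 0, (2 * α : ℝ) * s M α * c M α, 0; 0, 0, 0, 0; 0, 0, 0, 0; 0, 0, 0, 0],
    !![0, 0, 0, 0; 0, 0, 0, 0; 0, 0, 0, 0; 0, 0, 0, 0]]

/-- The dual coframe (as rows). -/
noncomputable def e : Matrix (Fin 4) (Fin 4) (Fun M α) :=
  !![0, 1, 0, 0;
    0, 0, 1, 0;
    α * Xi M α, 0, 0, (r M α ^ 2 - (α ^ 2 : ℝ)) * Xi M α;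
    Xi M α, 0, 0, -(α * s M α ^ 2 * Xi M α)]

/-- The squared lengths of the frame. -/
noncomputable def h : Fin 4 → Fun M α :=
  ![X M α * Di M α, X M α, s M α ^ 2 * X M α, D M α * X M α]

/-- `M (r² + α² cos² θ)`. -/
noncomputable def m : Fun M α := M * (r M α ^ 2 + (α ^ 2 : ℝ) * c M α ^ 2)

/-- `∇_t` in the frame. -/
noncomputable def wt : Matrix (Fin 4) (Fin 4) (Fun M α) :=
  !![0, 0, 0, -(m M α * D M α * Xi M α ^ 2);
    0, 0, -((2 * M * α : ℝ) * r M α * c M α * s M α * Xi M α ^ 2), 0;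
    0, (2 * M * α : ℝ) * r M α * c M α * si M α * Xi M α ^ 2, 0, 0;
    m M α * Di M α * Xi M α ^ 2, 0, 0, 0]

/-- `∇_r` in the frame. -/
noncomputable def wr : Matrix (Fin 4) (Fin 4) (Fun M α) :=
  !![r M α * Xi M α - (r M α - (M : ℝ)) * Di M α, (α ^ 2 : ℝ) * c M α * s M α * Xi M α, 0, 0;
    -((α ^ 2 : ℝ) * c M α * s M α * Xi M α * Di M α), r M α * Xi M α, 0, 0;
    0, 0, r M α * Xi M α, α * r M α * Xi M α;
    0, 0, -(α * r M α * s M α ^ 2 * Xi M α * Di M α),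
      (r M α - (M : ℝ)) * Di M α + r M α * Xi M α]

/-- `∇_θ` in the frame. -/
noncomputable def wθ : Matrix (Fin 4) (Fin 4) (Fun M α) :=
  !![(α ^ 2 : ℝ) * c M α * s M α * Xi M α, -(r M α * D M α * Xi M α), 0, 0;
    r M α * Xi M α, (α ^ 2 : ℝ) * c M α * s M α * Xi M α, 0, 0;
    0, 0, c M α * si M α + (α ^ 2 : ℝ) * c M α * s M α * Xi M α,
      -(α * c M α * D M α * si M α * Xi M α);
    0, 0, α * s M α * c M α * Xi M α, (α ^ 2 : ℝ) * c M α * s M α * Xi M α]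

/-- `∇_φ` in the frame. -/
noncomputable def wφ : Matrix (Fin 4) (Fin 4) (Fun M α) :=
  !![0, 0, -(r M α * s M α ^ 2 * D M α * Xi M α),
      α * s M α ^ 2 * D M α * (r M α * X M α + m M α) * Xi M α ^ 2;
    0, 0, -(s M α * c M α * ((r M α ^ 2 - (α ^ 2 : ℝ)) * X M α
        - (2 * M * α ^ 2 : ℝ) * r M α * s M α ^ 2) * Xi M α ^ 2),
      α * s M α * c M α * D M α * Xi M α;
    r M α * Xi M α, c M α * ((r M α ^ 2 - (α ^ 2 : ℝ)) * X M α
        - (2 * M * α ^ 2 : ℝ) * r M α * s M α ^ 2) * si M α * Xi M α ^ 2, 0, 0;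
    -(α * s M α ^ 2 * (r M α * X M α + m M α) * Di M α * Xi M α ^ 2),
      -(α * s M α * c M α * Xi M α), 0, 0]

/-- The connection matrices in the frame. -/
noncomputable def w : Fin 4 → Matrix (Fin 4) (Fin 4) (Fun M α) :=
  ![wt M α, wr M α, wθ M α, wφ M α]

variable {M α}

theorem kerrXi_eq : kerrXi α x = x 1 ^ 2 - α ^ 2 + α ^ 2 * Real.sin (x 2) ^ 2 := by
  rw [kerrXi, Real.cos_sq']
  ring

theorem e_mul_E {x : Fin 4 → ℝ} (hx : x ∈ kerrDomain M α) :
    (e M α).map (fun f => f.val x) * (E M α).map (fun f => f.val x) = 1 := by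
  have hX := hx.2.1.ne'
  have hX' := kerrXi_eq (α := α) x
  ext a b
  fin_cases a <;> fin_cases b <;> simp [e, E, Matrix.mul_apply, Fin.sum_univ_four] <;>
    field_simp <;> rw [hX'] <;> ring

end Kerr

theorem forall_fin_four {p : Fin 4 → Prop} (h0 : p 0) (h1 : p 1) (h2 : p 2) (h3 : p 3)
    (i : Fin 4) : p i := by
  fin_cases i <;> assumption

/-! ### Structure equations of the Kerr frame -/

namespace Kerr

variable {M α : ℝ}

theorem kerrMetric_eq_frame {x : Fin 4 → ℝ} (hx : x ∈ kerrDomain M α) :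
    kerrMetric M α x = ((e M α).map (fun f => f.val x)).transpose
      * Matrix.diagonal (fun a => (h M α a).val x) * (e M α).map (fun f => f.val x) := by
  have hX := hx.2.1.ne'
  have hD := hx.1.ne'
  ext i j
  simp only [kerrMetric, Matrix.mul_apply, Matrix.of_apply,
    Fin.sum_univ_four, Matrix.transpose_apply, Matrix.map_apply, h, kerrEta, kerrTau, kerrDr,
    kerrDtheta]
  fin_cases i <;> fin_cases j <;> simp [e] <;> field_simp

theorem hasPd_E (x : Fin 4 → ℝ) : ∀ i a b : Fin 4,
    (E M α a b).d i x = (dE M α i a b).val x := by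
  refine forall_fin_four ?_ ?_ ?_ ?_ <;> refine forall_fin_four ?_ ?_ ?_ ?_ <;>
    refine forall_fin_four ?_ ?_ ?_ ?_ <;> simp [E, dE]
  ring

/-- Each entry of `E` depends on at most one of `r` and `θ`, so mixed second derivatives vanish. -/
theorem ddE_eq_zero (x : Fin 4 → ℝ) : ∀ i j : Fin 4, i ≠ j → ∀ a b : Fin 4,
    (dE M α j a b).d i x = 0 := by
  refine forall_fin_four ?_ ?_ ?_ ?_ <;> refine forall_fin_four ?_ ?_ ?_ ?_ <;> intro hij <;>
    first | exact absurd rfl hij | clear hij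
  all_goals
    refine forall_fin_four ?_ ?_ ?_ ?_ <;> refine forall_fin_four ?_ ?_ ?_ ?_ <;> simp [dE]

theorem ddE_comm (x : Fin 4 → ℝ) (i j a b : Fin 4) :
    (dE M α j a b).d i x = (dE M α i a b).d j x := by
  rcases eq_or_ne i j with rfl | hij
  · rfl
  · rw [ddE_eq_zero x i j hij, ddE_eq_zero x j i hij.symm]

theorem h_ne_zero {x : Fin 4 → ℝ} (hx : x ∈ kerrDomain M α) (a : Fin 4) :
    (h M α a).val x ≠ 0 := by
  have hX := hx.2.1.ne'
  have hD := hx.1.ne'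
  have hs := sin_ne_zero hx
  fin_cases a <;> simp [h, hX, hD, hs]

set_option maxHeartbeats 1000000 in
theorem metric_compat {x : Fin 4 → ℝ} (hx : x ∈ kerrDomain M α) : ∀ i a b : Fin 4,
    (if a = b then (h M α a).d i x else 0)
      = (h M α a).val x * (w M α i a b).val x + (h M α b).val x * (w M α i b a).val x := by
  have hX := hx.2.1.ne'
  have hD := hx.1.ne'
  have hs := sin_ne_zero hx
  refine forall_fin_four ?_ ?_ ?_ ?_ <;> refine forall_fin_four ?_ ?_ ?_ ?_ <;>
    refine forall_fin_four ?_ ?_ ?_ ?_ <;> simp [h, w, wt, wr, wθ, wφ]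
  all_goals
    field_simp
    try ring

set_option maxHeartbeats 1000000 in
theorem torsion {x : Fin 4 → ℝ} (hx : x ∈ kerrDomain M α) (i j a : Fin 4) :
    (e M α a j).d i x + ∑ b, (w M α i a b).val x * (e M α b j).val x
      = (e M α a i).d j x + ∑ b, (w M α j a b).val x * (e M α b i).val x := by
  -- Exchanging `i` and `j` exchanges the two sides, which leaves six index pairs.
  wlog hij : i < j generalizing i j
  · rcases eq_or_ne i j with rfl | hne
    · rfl
    · exact (this j i (lt_of_le_of_ne (not_lt.1 hij) hne.symm)).symm
  have hX := hx.2.1.ne'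
  have hD := hx.1.ne'
  have hs := sin_ne_zero hx
  have hX' := kerrXi_eq (α := α) x
  have hc := Real.cos_sq_add_sin_sq (x 2)
  have hD' : kerrDelta M α x = x 1 ^ 2 - 2 * M * x 1 - α ^ 2 := rfl
  clear hx
  fin_cases i <;> fin_cases j <;> first | exact absurd hij (by decide) | skip
  all_goals
    clear hij
    fin_cases a <;> simp [e, w, wt, wr, wθ, wφ, m, Fin.sum_univ_four]
  all_goals
    field_simp
    clear hX hD hs
    grind

/-- The Kerr frame. -/
noncomputable def frame (M α : ℝ) : MovingFrame (kerrDomain M α) (kerrMetric M α) where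
  E x := (E M α).map fun f => f.val x
  e x := (e M α).map fun f => f.val x
  h x a := (h M α a).val x
  w i x := (w M α i).map fun f => f.val x
  dE i x := (dE M α i).map fun f => f.val x
  de i x := (e M α).map fun f => f.d i x
  dh i x a := (h M α a).d i x
  dw i j x := (w M α j).map fun f => f.d i x
  ddE i j x := (dE M α j).map fun f => f.d i x
  isOpen := isOpen_kerrDomain M α
  mul_eq_one _ hx := e_mul_E hx
  metric_eq _ hx := kerrMetric_eq_frame hx
  h_ne_zero _ hx := h_ne_zero hx
  hasPd_E x hx i a b := by
    rw [Matrix.map_apply, ← hasPd_E]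
    exact (E M α a b).hasPd x hx i
  hasPd_e x hx i a b := (e M α a b).hasPd x hx i
  hasPd_h x hx i a := (h M α a).hasPd x hx i
  hasPd_w x hx i j a b := (w M α j a b).hasPd x hx i
  hasPd_dE x hx i j a b := (dE M α j a b).hasPd x hx i
  ddE_comm x _ i j := by
    ext a b
    exact ddE_comm x i j a b
  metric x hx i := by
    ext a b
    have := metric_compat hx i a b
    simpa [Matrix.diagonal_apply, mul_comm] using this
  torsion x hx i j a := by
    simpa [Matrix.mul_apply] using torsion hx i j a

end Kerr

/-! ### Algebraic curvature tensors of type D -/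

/-- The anti-self-dual counterpart of `selfDualBasis`. -/
def antiSelfDualBasis : Fin 3 → Matrix (Fin 4) (Fin 4) ℝ :=
  ![wedgeBasis 0 1 - wedgeBasis 2 3,
    wedgeBasis 0 2 - wedgeBasis 3 1,
    wedgeBasis 0 3 - wedgeBasis 1 2]

/-- The Ricci-flat algebraic curvature tensor whose operator has eigenvalues `p, p, -2 p` on
self-dual and `q, q, -2 q` on anti-self-dual forms. -/
noncomputable def typeD (p q : ℝ) (a b c d : Fin 4) : ℝ :=
  ∑ k, ![1, 1, -2] k * (p / 2 * (selfDualBasis k a b * selfDualBasis k c d)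
    + q / 2 * (antiSelfDualBasis k a b * antiSelfDualBasis k c d))

theorem selfDualBasis_eq : selfDualBasis =
    ![!![0, 1, 0, 0; -1, 0, 0, 0; 0, 0, 0, 1; 0, 0, -1, 0],
      !![0, 0, 1, 0; 0, 0, 0, -1; -1, 0, 0, 0; 0, 1, 0, 0],
      !![0, 0, 0, 1; 0, 0, 1, 0; 0, -1, 0, 0; -1, 0, 0, 0]] := by
  ext k a b
  fin_cases k <;> fin_cases a <;> fin_cases b <;>
    simp [selfDualBasis, wedgeBasis]

theorem antiSelfDualBasis_eq : antiSelfDualBasis =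
    ![!![0, 1, 0, 0; -1, 0, 0, 0; 0, 0, 0, -1; 0, 0, 1, 0],
      !![0, 0, 1, 0; 0, 0, 0, 1; -1, 0, 0, 0; 0, -1, 0, 0],
      !![0, 0, 0, 1; 0, 0, -1, 0; 0, 1, 0, 0; -1, 0, 0, 0]] := by
  ext k a b
  fin_cases k <;> fin_cases a <;> fin_cases b <;>
    simp [antiSelfDualBasis, wedgeBasis]

set_option maxHeartbeats 1000000 in
-- Each basis form satisfies `Ωᵀ Ω = 1`, so every contraction is a multiple of the identity, and the
-- weights `1, 1, -2` add up to zero.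
theorem typeD_ricci (p q : ℝ) : ∀ b d : Fin 4, ∑ a, typeD p q a b a d = 0 := by
  refine forall_fin_four ?_ ?_ ?_ ?_ <;> refine forall_fin_four ?_ ?_ ?_ ?_ <;>
    simp [typeD, selfDualBasis_eq, antiSelfDualBasis_eq, Fin.sum_univ_four, Fin.sum_univ_three]
  all_goals ring

theorem selfDualBasis_contract (j k : Fin 3) :
    ∑ c, ∑ d, selfDualBasis j c d * selfDualBasis k c d = if j = k then 4 else 0 := by
  fin_cases j <;> fin_cases k <;> simp [selfDualBasis_eq, Fin.sum_univ_four] <;> norm_num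

theorem antiSelfDualBasis_contract (j k : Fin 3) :
    ∑ c, ∑ d, antiSelfDualBasis j c d * selfDualBasis k c d = 0 := by
  fin_cases j <;> fin_cases k <;>
    simp [selfDualBasis_eq, antiSelfDualBasis_eq, Fin.sum_univ_four]

/-- Self-dual forms are mutually orthogonal and orthogonal to anti-self-dual ones. The contraction
value `4` cancels the factor `1/2` of the operator and the `1/2` in `typeD`. -/
theorem formOperator_typeD (p q : ℝ) (k : Fin 3) :
    formOperator (typeD p q) (selfDualBasis k) = (![p, p, -2 * p] k) • selfDualBasis k := by
  ext a b
  have key : ∑ c, ∑ d, typeD p q a b c d * selfDualBasis k c d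
      = ∑ j, ![1, 1, -2] j * (p / 2 * selfDualBasis j a b
          * ∑ c, ∑ d, selfDualBasis j c d * selfDualBasis k c d
        + q / 2 * antiSelfDualBasis j a b
          * ∑ c, ∑ d, antiSelfDualBasis j c d * selfDualBasis k c d) := by
    simp only [Finset.mul_sum, ← Finset.sum_add_distrib, typeD, Finset.sum_mul]
    rw [Finset.sum_comm]
    conv_lhs => enter [2, d]; rw [Finset.sum_comm]
    rw [Finset.sum_comm]
    refine Finset.sum_congr rfl fun j _ => ?_
    rw [Finset.sum_comm]
    refine Finset.sum_congr rfl fun c _ => Finset.sum_congr rfl fun d _ => ?_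
    ring
  rw [formOperator, Matrix.of_apply, key]
  simp only [selfDualBasis_contract, antiSelfDualBasis_contract, Matrix.smul_apply, smul_eq_mul]
  fin_cases k <;> simp <;> ring

/-- Evaluating an expansion in the coframe on the dual frame returns the coefficients; duality is
applied to one index at a time, which is why the sums are nested. -/
theorem frameComp_of_expansion {f θ : Fin 4 → Fin 4 → ℝ} {R T : Fin 4 → Fin 4 → Fin 4 → Fin 4 → ℝ}
    (hd : ∀ a b, ∑ i, θ a i * f b i = if a = b then 1 else 0)
    (hT : ∀ i j k l, T i j k l
      = ∑ s, θ s l * ∑ r, θ r k * ∑ q, θ q j * ∑ p, θ p i * R p q r s) :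
    frameComp f T = R := by
  have key : ∀ (c : ℝ) (b : Fin 4) (G : Fin 4 → ℝ),
      ∑ i, c * f b i * ∑ a, θ a i * G a = c * G b := fun c b G => by
    simp only [Finset.mul_sum]
    rw [Finset.sum_comm]
    have : ∀ a, ∑ i, c * f b i * (θ a i * G a) = c * G a * ∑ i, θ a i * f b i := fun a => by
      rw [Finset.mul_sum]
      exact Finset.sum_congr rfl fun i _ => by ring
    simp [this, hd]
  ext a b c d
  simp only [frameComp, hT, key]
  simpa using key 1 a _

/-! ### Curvature of the Kerr metric -/

namespace Kerr

variable {M α : ℝ}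

/-- The first curvature coefficient. -/
noncomputable def mu (M α : ℝ) (x : Fin 4 → ℝ) : ℝ :=
  -(M * (x 1 ^ 3 + 3 * x 1 * α ^ 2 * Real.cos (x 2) ^ 2) / kerrXi α x ^ 3)

/-- The second curvature coefficient. -/
noncomputable def nu (M α : ℝ) (x : Fin 4 → ℝ) : ℝ :=
  -(M * (3 * x 1 ^ 2 * α * Real.cos (x 2) + α ^ 3 * Real.cos (x 2) ^ 3) / kerrXi α x ^ 3)

/-- The two-forms `eᵃ ∧ eᵇ` of the coframe `e`. -/
noncomputable def wedge (M α : ℝ) (x : Fin 4 → ℝ) (i j a b : Fin 4) : ℝ :=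
  (e M α a i).val x * (e M α b j).val x - (e M α a j).val x * (e M α b i).val x

/-- The curvature matrix in the frame. -/
noncomputable def K (M α : ℝ) (x : Fin 4 → ℝ) (i j : Fin 4) : Matrix (Fin 4) (Fin 4) ℝ :=
  let X := kerrXi α x
  let D := kerrDelta M α x
  let s := Real.sin (x 2)
  let W := wedge M α x i j
  let k01 := mu M α x * X * W 0 1 + nu M α x * s * D * X * W 2 3
  let k02 := mu M α x * s ^ 2 * X * W 0 2 + nu M α x * s * D * X * W 3 1
  let k03 := -2 * mu M α x * D * X * W 0 3 - 2 * nu M α x * s * D * X * W 1 2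
  let k12 := -2 * mu M α x * s ^ 2 * X * W 1 2 - 2 * nu M α x * s * X * W 0 3
  let k13 := mu M α x * D * X * W 1 3 - nu M α x * s * X * W 0 2
  let k23 := mu M α x * D * X * W 2 3 + nu M α x * X / s * W 0 1
  !![0, k01, k02, k03;
    -k01 / D, 0, k12, k13;
    -k02 / (s ^ 2 * D), -k12 / s ^ 2, 0, k23;
    -k03 / D ^ 2, -k13 / D, -k23 * s ^ 2 / D, 0]

set_option maxHeartbeats 4000000 in
-- The explicit evaluation of `dw + w ∧ w`. Once denominators are cleared, each entry is a
-- polynomial identity modulo `cos² + sin² = 1` and the formulas for `Ξ` and `Δ`.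
theorem curv_eq_of_lt {x : Fin 4 → ℝ} (hx : x ∈ kerrDomain M α) :
    ∀ i j : Fin 4, i < j → ∀ a b : Fin 4, (frame M α).curv i j x a b = K M α x i j a b := by
  have hX := hx.2.1.ne'
  have hD := hx.1.ne'
  have hs := sin_ne_zero hx
  have hX' := kerrXi_eq (α := α) x
  have hc := Real.cos_sq_add_sin_sq (x 2)
  have hD' : kerrDelta M α x = x 1 ^ 2 - 2 * M * x 1 - α ^ 2 := rfl
  clear hx
  refine forall_fin_four ?_ ?_ ?_ ?_ <;> refine forall_fin_four ?_ ?_ ?_ ?_ <;> intro hij <;>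
    first | exact absurd hij (by decide) | clear hij
  all_goals
    refine forall_fin_four ?_ ?_ ?_ ?_ <;> refine forall_fin_four ?_ ?_ ?_ ?_ <;>
    simp [K, wedge, mu, nu, MovingFrame.curv, frame, Matrix.mul_apply, e, w, wt, wr, wθ, wφ, m,
      Fin.sum_univ_four]
  all_goals
    field_simp
    clear hX hD hs
    grind

end Kerr

namespace Kerr

variable {M α : ℝ}

theorem wedge_swap (x : Fin 4 → ℝ) (i j a b : Fin 4) :
    wedge M α x i j a b = -wedge M α x j i a b := by
  unfold wedge
  ring

theorem curv_eq {x : Fin 4 → ℝ} (hx : x ∈ kerrDomain M α) (i j a b : Fin 4) :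
    (frame M α).curv i j x a b = K M α x i j a b := by
  have hF : (frame M α).curv i j x a b = -(frame M α).curv j i x a b := by
    rw [← Matrix.neg_apply]
    refine congrArg (fun N : Matrix (Fin 4) (Fin 4) ℝ => N a b) ?_
    simp only [MovingFrame.curv]
    abel
  have hK : K M α x i j a b = -K M α x j i a b := by
    simp only [K, wedge_swap x i j]
    revert a b
    refine forall_fin_four ?_ ?_ ?_ ?_ <;> refine forall_fin_four ?_ ?_ ?_ ?_ <;> intro _ <;>
      simp <;> ring
  rcases lt_trichotomy i j with h | rfl | h
  · exact curv_eq_of_lt hx i j h a b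
  · linarith
  · rw [hF, hK, curv_eq_of_lt hx j i h]

/-! ### Passage to the orthonormal frame -/

/-- The lengths of the frame. -/
noncomputable def n (M α : ℝ) (x : Fin 4 → ℝ) : Fin 4 → ℝ :=
  ![Real.sqrt (kerrXi α x) / Real.sqrt (kerrDelta M α x), Real.sqrt (kerrXi α x),
    Real.sin (x 2) * Real.sqrt (kerrXi α x),
    Real.sqrt (kerrXi α x) * Real.sqrt (kerrDelta M α x)]

theorem n_ne_zero {x : Fin 4 → ℝ} (hx : x ∈ kerrDomain M α) : ∀ a, n M α x a ≠ 0 := by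
  have hX := (Real.sqrt_pos.2 hx.2.1).ne'
  have hD := (Real.sqrt_pos.2 hx.1).ne'
  have hs := sin_ne_zero hx
  refine forall_fin_four ?_ ?_ ?_ ?_ <;> simp [n, hX, hD, hs]

theorem n_sq {x : Fin 4 → ℝ} (hx : x ∈ kerrDomain M α) : ∀ a, n M α x a ^ 2 = (h M α a).val x := by
  have hX := Real.sq_sqrt hx.2.1.le
  have hD := Real.sq_sqrt hx.1.le
  refine forall_fin_four ?_ ?_ ?_ ?_ <;> simp [n, h, mul_pow, div_pow, hX, hD] <;> ring

theorem coframe_eq {x : Fin 4 → ℝ} (hx : x ∈ kerrDomain M α) : ∀ a i,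
    kerrCoframe M α x a i = n M α x a * (e M α a i).val x := by
  have hX := (Real.sqrt_pos.2 hx.2.1).ne'
  have hD := (Real.sqrt_pos.2 hx.1).ne'
  have hX' := Real.sq_sqrt hx.2.1.le
  have hXi : kerrXi α x ≠ 0 := hx.2.1.ne'
  refine forall_fin_four ?_ ?_ ?_ ?_ <;> refine forall_fin_four ?_ ?_ ?_ ?_ <;>
    simp [kerrCoframe, n, e, kerrDr, kerrDtheta, kerrEta, kerrTau, Real.sqrt_div hx.2.1.le,
      Real.sqrt_div hx.1.le]
  all_goals
    field_simp
    rw [hX']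
    try ring

theorem frame_eq {x : Fin 4 → ℝ} (hx : x ∈ kerrDomain M α) : ∀ a i,
    n M α x a * kerrFrame M α x a i = (E M α i a).val x := by
  have hX := (Real.sqrt_pos.2 hx.2.1).ne'
  have hD := (Real.sqrt_pos.2 hx.1).ne'
  have hs := sin_ne_zero hx
  refine forall_fin_four ?_ ?_ ?_ ?_ <;> refine forall_fin_four ?_ ?_ ?_ ?_ <;>
    simp [kerrFrame, n, E, Real.sqrt_div hx.1.le, Real.sqrt_mul hx.1.le]
  all_goals field_simp

/-- The frame components of the curvature tensor. -/
noncomputable def R (M α : ℝ) (x : Fin 4 → ℝ) : Fin 4 → Fin 4 → Fin 4 → Fin 4 → ℝ :=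
  typeD (mu M α x + nu M α x) (mu M α x - nu M α x)

set_option maxHeartbeats 4000000 in
-- Normalising the frame conjugates an endomorphism matrix by the lengths `n`. Multiplying through
-- by `n d` avoids division.
theorem curv_eq_R {x : Fin 4 → ℝ} (hx : x ∈ kerrDomain M α) (i j : Fin 4) : ∀ c d : Fin 4,
    n M α x c * (frame M α).curv i j x c d
      = n M α x d * ∑ q, kerrCoframe M α x q j * ∑ p, kerrCoframe M α x p i * R M α x p q c d := by
  have hX := (Real.sqrt_pos.2 hx.2.1).ne'
  have hD := (Real.sqrt_pos.2 hx.1).ne'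
  have hX' := Real.sq_sqrt hx.2.1.le
  have hD' := Real.sq_sqrt hx.1.le
  have hs := sin_ne_zero hx
  simp only [curv_eq hx, coframe_eq hx, R, K, wedge, n]
  -- The identity no longer depends on the values of the coefficients, the roots or the coframe
  -- entries; only `Ξ = u²` and `Δ = v²` are used.
  generalize mu M α x = μ
  generalize nu M α x = ν
  generalize Real.sqrt (kerrXi α x) = u at *
  generalize Real.sqrt (kerrDelta M α x) = v at *
  generalize (Real.sin (x 2)) = s at *
  simp only [← hX', ← hD']
  generalize (fun a i => (e M α a i).val x) = y
  refine forall_fin_four ?_ ?_ ?_ ?_ <;> refine forall_fin_four ?_ ?_ ?_ ?_ <;>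
    simp [typeD, selfDualBasis_eq, antiSelfDualBasis_eq, Fin.sum_univ_four, Fin.sum_univ_three]
  all_goals
    try field_simp
    try ring

/-- Lowering the index with `g = eᵀ h e` cancels `E` against `e`; the remaining factor `h = n²`
supplies the lengths that turn `e` into the orthonormal coframe. -/
theorem riemann_eq {x : Fin 4 → ℝ} (hx : x ∈ kerrDomain M α) (i j k l : Fin 4) :
    riemann (kerrMetric M α) x i j k l
      = ∑ s, kerrCoframe M α x s l * ∑ r, kerrCoframe M α x r k
        * ∑ q, kerrCoframe M α x q j * ∑ p, kerrCoframe M α x p i * R M α x p q r s := by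
  have h1 : riemann (kerrMetric M α) x i j k l
      = (kerrMetric M α x * ((frame M α).E x * (frame M α).curv i j x * (frame M α).e x)) k l := by
    simp only [riemann, (frame M α).curvature_eq hx, Matrix.mul_apply]
  have h2 : kerrMetric M α x * ((frame M α).E x * (frame M α).curv i j x * (frame M α).e x)
      = ((frame M α).e x).transpose * Matrix.diagonal ((frame M α).h x)
        * (frame M α).curv i j x * (frame M α).e x := by
    calc kerrMetric M α x * ((frame M α).E x * (frame M α).curv i j x * (frame M α).e x)
        = ((frame M α).e x).transpose * Matrix.diagonal ((frame M α).h x)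
          * ((frame M α).e x * (frame M α).E x) * (frame M α).curv i j x * (frame M α).e x := by
          rw [(frame M α).metric_eq x hx]
          noncomm_ring
      _ = _ := by rw [(frame M α).mul_eq_one x hx, mul_one]
  rw [h1, h2, Matrix.mul_apply]
  refine Finset.sum_congr rfl fun s _ => ?_
  rw [Matrix.mul_apply, Finset.sum_mul, Finset.mul_sum]
  refine Finset.sum_congr rfl fun r _ => ?_
  have h3 := curv_eq_R hx i j r s
  have h4 := n_ne_zero hx s
  have h5 : (frame M α).h x r = n M α x r ^ 2 := (n_sq hx r).symm
  have h6 : (∑ q, kerrCoframe M α x q j * ∑ p, kerrCoframe M α x p i * R M α x p q r s)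
      = n M α x r * (frame M α).curv i j x r s / n M α x s := by
    rw [h3]
    field_simp
  have h7 : ∀ a i, (frame M α).e x a i = (e M α a i).val x := fun _ _ => rfl
  rw [h6, Matrix.mul_diagonal, Matrix.transpose_apply, h5, coframe_eq hx, coframe_eq hx, h7, h7]
  field_simp

theorem frameComp_riemann {x : Fin 4 → ℝ} (hx : x ∈ kerrDomain M α) :
    frameComp (kerrFrame M α x) (riemann (kerrMetric M α) x) = R M α x :=
  frameComp_of_expansion (kerrCoframe_frame M α hx) (riemann_eq hx)

/-! ### Ricci-flatness and the Weyl eigenvalue -/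

theorem ricci_eq_zero {x : Fin 4 → ℝ} (hx : x ∈ kerrDomain M α) (j k : Fin 4) :
    ricci (kerrMetric M α) x j k = 0 := by
  have h1 : ∀ i, curvature (kerrMetric M α) i k i j x
      = ∑ d, ∑ c, ∑ q, ∑ p, (e M α d k).val x * n M α x d * kerrCoframe M α x q j
          * R M α x p q c d * (kerrCoframe M α x p i * kerrFrame M α x c i) := fun i => by
    rw [(frame M α).curvature_eq hx, Matrix.mul_apply]
    refine Finset.sum_congr rfl fun d _ => ?_
    rw [Matrix.mul_apply, Finset.sum_mul]
    refine Finset.sum_congr rfl fun c _ => ?_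
    have h2 : (frame M α).E x i c = (E M α i c).val x := rfl
    have h3 : (frame M α).e x d k = (e M α d k).val x := rfl
    rw [h2, h3, ← frame_eq hx, mul_right_comm (n M α x c), curv_eq_R hx]
    simp only [Finset.mul_sum, Finset.sum_mul]
    refine Finset.sum_congr rfl fun q _ => Finset.sum_congr rfl fun p _ => ?_
    ring
  -- Summing over the coordinate index `i` first gives `δ_{pc}` by duality, leaving the Ricci
  -- contraction of `typeD`.
  have h4 : ∀ d q, ∑ c, ∑ p, ∑ i, (e M α d k).val x * n M α x d * kerrCoframe M α x q j
          * R M α x p q c d * (kerrCoframe M α x p i * kerrFrame M α x c i) = 0 := fun d q => by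
    have := typeD_ricci (mu M α x + nu M α x) (mu M α x - nu M α x) q d
    simp only [← Finset.mul_sum, kerrCoframe_frame M α hx, mul_ite, mul_one, mul_zero,
      Finset.sum_ite_eq', Finset.mem_univ, if_true]
    rw [R, this, mul_zero]
  rw [ricci]
  simp only [h1]
  rw [Finset.sum_comm]
  refine Finset.sum_eq_zero fun d _ => ?_
  rw [Finset.sum_comm]
  calc ∑ c, ∑ i, ∑ q, ∑ p, _ = ∑ c, ∑ q, ∑ p, ∑ i, _ := by
        refine Finset.sum_congr rfl fun c _ => ?_
        rw [Finset.sum_comm]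
        refine Finset.sum_congr rfl fun q _ => ?_
        rw [Finset.sum_comm]
    _ = ∑ q, ∑ c, ∑ p, ∑ i, _ := Finset.sum_comm
    _ = 0 := Finset.sum_eq_zero fun q _ => h4 d q

theorem scalarCurv_eq_zero {x : Fin 4 → ℝ} (hx : x ∈ kerrDomain M α) :
    scalarCurv (kerrMetric M α) x = 0 := by
  simp [scalarCurv, ricci_eq_zero hx]

theorem weyl_eq_riemann {x : Fin 4 → ℝ} (hx : x ∈ kerrDomain M α) :
    weyl (kerrMetric M α) x = riemann (kerrMetric M α) x := by
  ext i j k l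
  simp [weyl, ricci_eq_zero hx, scalarCurv_eq_zero hx]

theorem kerrXi_eq_mul (x : Fin 4 → ℝ) :
    kerrXi α x = kerrRho α x * (x 1 + α * Real.cos (x 2)) := by
  rw [kerrXi, kerrRho]
  ring

/-- Only nonvanishing is available: the domain also allows negative `r`, where `r - α cos θ` is
negative. -/
theorem kerrRho_ne_zero {x : Fin 4 → ℝ} (hx : x ∈ kerrDomain M α) : kerrRho α x ≠ 0 := by
  have := hx.2.1.ne'
  rw [kerrXi_eq_mul] at this
  exact left_ne_zero_of_mul this

/-- The numerators add up to the binomial cube `(r + α cos θ)³`, which cancels against the same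
factor of `Ξ³`. -/
theorem mu_add_nu {x : Fin 4 → ℝ} (hx : x ∈ kerrDomain M α) :
    mu M α x + nu M α x = -M / kerrRho α x ^ 3 := by
  have h1 := hx.2.1.ne'
  have h2 := kerrRho_ne_zero hx
  have h3 := kerrXi_eq_mul (α := α) x
  have h4 : x 1 + α * Real.cos (x 2) ≠ 0 := by
    rw [h3] at h1
    exact right_ne_zero_of_mul h1
  rw [mu, nu, h3]
  field_simp
  ring

end Kerr

/-! ### The self-dual Weyl operator -/

theorem selfDualBlock_typeD (p q : ℝ) :
    selfDualBlock (typeD p q) = Matrix.diagonal ![p, p, -2 * p] := by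
  ext i j
  simp only [selfDualBlock, Matrix.of_apply, formOperator_typeD]
  fin_cases i <;> fin_cases j <;>
    simp [formInner, selfDualBasis_eq, Fin.sum_univ_four] <;> ring

theorem roots_charpoly_diagonal_fin_three (d : Fin 3 → ℝ) :
    (Matrix.diagonal d).charpoly.roots = {d 0, d 1, d 2} := by
  rw [Matrix.charpoly_diagonal, Polynomial.roots_prod _ _
    (by simp [Finset.prod_ne_zero_iff, Polynomial.X_sub_C_ne_zero])]
  simp
  rfl

theorem ncard_eigenvalue_diagonal {a b : ℝ} (hab : a ≠ b) :
    {μ : ℝ | Module.End.HasEigenvalue (Matrix.toLin' (Matrix.diagonal ![a, a, b])) μ}.ncard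
      = 2 := by
  have : {μ : ℝ | Module.End.HasEigenvalue (Matrix.toLin' (Matrix.diagonal ![a, a, b])) μ}
      = {a, b} := by
    ext μ
    simp [hasEigenvalue_toLin'_diagonal_iff, Fin.exists_fin_succ, eq_comm]
  rw [this, Set.ncard_pair hab]

/-- No sign condition on `ρ` is needed, because only its even powers `ρ⁶ = (ρ²)³` occur. -/
theorem rpow_two_thirds_sqrt {M ρ : ℝ} (hM : 0 < M) :
    Real.sqrt (6 * M ^ 2 / ρ ^ 6) ^ (2 / 3 : ℝ)
      = (6 : ℝ) ^ (1 / 3 : ℝ) * M ^ (2 / 3 : ℝ) / ρ ^ 2 := by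
  have h1 : (0 : ℝ) ≤ 6 * M ^ 2 / ρ ^ 6 := by positivity
  have h2 : (ρ ^ 6) ^ (1 / 3 : ℝ) = ρ ^ 2 := by
    have : ρ ^ 6 = (ρ ^ 2) ^ ((3 : ℕ) : ℝ) := by
      rw [Real.rpow_natCast]
      ring
    rw [this, ← Real.rpow_mul (by positivity)]
    norm_num
  have h3 : (M ^ 2) ^ (1 / 3 : ℝ) = M ^ (2 / 3 : ℝ) := by
    rw [← Real.rpow_natCast, ← Real.rpow_mul hM.le]
    norm_num
  rw [Real.sqrt_eq_rpow, ← Real.rpow_mul h1, show (1 / 2 * (2 / 3) : ℝ) = 1 / 3 by norm_num,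
    Real.div_rpow (by positivity) (by positivity), Real.mul_rpow (by norm_num) (by positivity),
    h2, h3]

namespace Kerr

variable {M α : ℝ}

theorem frameComp_weyl {x : Fin 4 → ℝ} (hx : x ∈ kerrDomain M α) :
    frameComp (kerrFrame M α x) (weyl (kerrMetric M α) x)
      = typeD (-M / kerrRho α x ^ 3) (mu M α x - nu M α x) := by
  rw [weyl_eq_riemann hx, frameComp_riemann hx, R, mu_add_nu hx]

theorem eigenvalues_eq (x : Fin 4 → ℝ) :
    ![-M / kerrRho α x ^ 3, -M / kerrRho α x ^ 3, -2 * (-M / kerrRho α x ^ 3)]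
      = ![-M / kerrRho α x ^ 3, -M / kerrRho α x ^ 3, 2 * M / kerrRho α x ^ 3] := by
  rw [show -2 * (-M / kerrRho α x ^ 3) = 2 * M / kerrRho α x ^ 3 by ring]

theorem wPlus_eq {x : Fin 4 → ℝ} (hx : x ∈ kerrDomain M α) :
    kerrWPlus M α x = Matrix.diagonal
      ![-M / kerrRho α x ^ 3, -M / kerrRho α x ^ 3, 2 * M / kerrRho α x ^ 3] := by
  rw [kerrWPlus, frameComp_weyl hx, selfDualBlock_typeD, eigenvalues_eq]

theorem formOperator_weyl {x : Fin 4 → ℝ} (hx : x ∈ kerrDomain M α) (p : Fin 3) :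
    formOperator (frameComp (kerrFrame M α x) (weyl (kerrMetric M α) x)) (selfDualBasis p)
      = (![-M / kerrRho α x ^ 3, -M / kerrRho α x ^ 3, 2 * M / kerrRho α x ^ 3] p)
        • selfDualBasis p := by
  rw [frameComp_weyl hx, formOperator_typeD, eigenvalues_eq]

theorem kerrA_eq {x : Fin 4 → ℝ} (hx : x ∈ kerrDomain M α) :
    kerrA M α x = kerrWPlus M α x := by
  rw [kerrA, kerrWPlus, weyl_eq_riemann hx]

theorem wPlus_roots {x : Fin 4 → ℝ} (hx : x ∈ kerrDomain M α) :
    (kerrWPlus M α x).charpoly.roots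
      = {-M / kerrRho α x ^ 3, -M / kerrRho α x ^ 3, 2 * M / kerrRho α x ^ 3} := by
  rw [wPlus_eq hx, roots_charpoly_diagonal_fin_three]
  rfl

theorem eigenvalue_ne (hM : 0 < M) {x : Fin 4 → ℝ} (hx : x ∈ kerrDomain M α) :
    -M / kerrRho α x ^ 3 ≠ 2 * M / kerrRho α x ^ 3 := by
  have hρ := kerrRho_ne_zero hx
  intro h
  field_simp at h
  linarith

theorem wPlus_ne_zero (hM : 0 < M) {x : Fin 4 → ℝ} (hx : x ∈ kerrDomain M α) :
    kerrWPlus M α x ≠ 0 := by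
  have hρ := kerrRho_ne_zero hx
  rw [wPlus_eq hx]
  intro h
  have := congrFun (congrFun h 2) 2
  simp [hM.ne', hρ] at this

theorem wPlus_norm (hM : 0 < M) {x : Fin 4 → ℝ} (hx : x ∈ kerrDomain M α) :
    eigenNorm (kerrWPlus M α x) ^ (2 / 3 : ℝ)
      = (6 : ℝ) ^ (1 / 3 : ℝ) * M ^ (2 / 3 : ℝ) / kerrRho α x ^ 2 := by
  rw [← rpow_two_thirds_sqrt hM, eigenNorm, wPlus_roots hx]
  congr 2
  simp only [Multiset.insert_eq_cons, Multiset.map_cons, Multiset.map_singleton,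
    Multiset.sum_cons, Multiset.sum_singleton]
  ring

end Kerr

/-! ### The Lee form -/

namespace Kerr

variable {M α : ℝ}

/-- The almost complex structure in the frame, `J E_a = ∑ Jf b a E_b`. -/
noncomputable def Jf (M α : ℝ) : Matrix (Fin 4) (Fin 4) (Fun M α) :=
  !![0, 0, 0, -D M α; 0, 0, -s M α, 0; 0, si M α, 0, 0; Di M α, 0, 0, 0]

/-- The length ratios between frame vectors paired by `J` are `Δ` and `sin θ`, so `J` has root-free
entries in the unnormalised frame. -/
theorem Jf_eq {x : Fin 4 → ℝ} (hx : x ∈ kerrDomain M α) : ∀ a b,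
    n M α x a * kerrJframe a b = (Jf M α b a).val x * n M α x b := by
  have hX := (Real.sqrt_pos.2 hx.2.1).ne'
  have hD := (Real.sqrt_pos.2 hx.1).ne'
  have hD' := Real.sq_sqrt hx.1.le
  have hD0 : kerrDelta M α x ≠ 0 := hx.1.ne'
  have hs := sin_ne_zero hx
  refine forall_fin_four ?_ ?_ ?_ ?_ <;> refine forall_fin_four ?_ ?_ ?_ ?_ <;>
    simp [n, Jf, kerrJframe]
  all_goals
    field_simp
    try rw [hD']

theorem kerrJ_transpose {x : Fin 4 → ℝ} (hx : x ∈ kerrDomain M α) :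
    (kerrJ M α x).transpose
      = (frame M α).E x * (Jf M α).map (fun f => f.val x) * (frame M α).e x := by
  ext j i
  rw [Matrix.transpose_apply, kerrJ, Matrix.of_apply, Matrix.mul_apply]
  refine Finset.sum_congr rfl fun a _ => ?_
  rw [Matrix.mul_apply, Finset.sum_mul]
  refine Finset.sum_congr rfl fun b _ => ?_
  have h1 : (frame M α).E x j b = n M α x b * kerrFrame M α x b j := (frame_eq hx b j).symm
  have h2 : (frame M α).e x a i = (e M α a i).val x := rfl
  rw [h1, h2, coframe_eq hx, Matrix.map_apply]
  linear_combination (e M α a i).val x * kerrFrame M α x b j * Jf_eq hx a b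

set_option maxHeartbeats 1000000 in
-- The divergence is the trace of `dJ + [w, J]`, the factor `E a c` converting the derivative index
-- to the frame. Applying `J` to this covector and changing sign gives the Lee form.
theorem divergence_Jf {x : Fin 4 → ℝ} (hx : x ∈ kerrDomain M α) : ∀ d,
    ∑ a, ∑ c, (E M α a c).val x * ((Jf M α c d).d a x
      + (∑ m, (w M α a c m).val x * (Jf M α m d).val x
        - ∑ m, (Jf M α c m).val x * (w M α a m d).val x))
    = ![0, 0, -(2 * α * Real.sin (x 2) ^ 2 / kerrRho α x),
        -(2 * kerrDelta M α x / kerrRho α x)] d := by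
  have hX := hx.2.1.ne'
  have hD := hx.1.ne'
  have hs := sin_ne_zero hx
  have hρ := kerrRho_ne_zero hx
  have hX' : kerrXi α x = x 1 ^ 2 - α ^ 2 * Real.cos (x 2) ^ 2 := rfl
  have hρ' : kerrRho α x = x 1 - α * Real.cos (x 2) := rfl
  have hc := Real.cos_sq_add_sin_sq (x 2)
  have hD' : kerrDelta M α x = x 1 ^ 2 - 2 * M * x 1 - α ^ 2 := rfl
  clear hx
  refine forall_fin_four ?_ ?_ ?_ ?_ <;>
    simp [E, Jf, w, wt, wr, wθ, wφ, m, Fin.sum_univ_four]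
  all_goals
    field_simp
    clear hX hD hs hρ
    grind

theorem leeForm_eq {x : Fin 4 → ℝ} (hx : x ∈ kerrDomain M α) :
    leeForm (kerrMetric M α) (kerrJ M α) x
      = ![0, 2 / kerrRho α x, 2 * α * Real.sin (x 2) / kerrRho α x, 0] := by
  have hdual : ∀ d c, ∑ b, (frame M α).e x d b * (frame M α).E x b c = if d = c then 1 else 0 :=
    fun d c => by
      have := congrFun (congrFun ((frame M α).mul_eq_one x hx) d) c
      rwa [Matrix.mul_apply, Matrix.one_apply] at this
  have hcov : ∀ a b, covDerivEnd (kerrMetric M α) (kerrJ M α) a b a x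
      = ∑ d, (∑ c, (E M α a c).val x * ((Jf M α c d).d a x
        + (∑ m, (w M α a c m).val x * (Jf M α m d).val x
          - ∑ m, (Jf M α c m).val x * (w M α a m d).val x))) * (frame M α).e x d b := fun a b => by
    have hA : HasPdM a (fun y => (Jf M α).map fun f => f.val y)
        ((Jf M α).map fun f => f.d a x) x := fun b c => (Jf M α b c).hasPd x hx a
    rw [(frame M α).covDerivEnd_eq hx (fun y hy => kerrJ_transpose hy) hA, Matrix.mul_apply]
    refine Finset.sum_congr rfl fun d _ => ?_
    rw [Matrix.mul_apply]
    refine congrArg (· * (frame M α).e x d b) (Finset.sum_congr rfl fun c _ => ?_)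
    rw [Matrix.sub_apply, Matrix.add_apply, Matrix.mul_apply, Matrix.mul_apply, add_sub_assoc]
    rfl
  have hdiv : ∀ b, ∑ a, covDerivEnd (kerrMetric M α) (kerrJ M α) a b a x
      = ∑ d, ![0, 0, -(2 * α * Real.sin (x 2) ^ 2 / kerrRho α x),
        -(2 * kerrDelta M α x / kerrRho α x)] d * (frame M α).e x d b := fun b => by
    simp only [hcov]
    rw [Finset.sum_comm]
    refine Finset.sum_congr rfl fun d _ => ?_
    rw [← Finset.sum_mul, divergence_Jf hx]
  have hJ : ∀ d i, ∑ b, (frame M α).e x d b * kerrJ M α x i b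
      = ∑ c, (Jf M α d c).val x * (e M α c i).val x := fun d i => by
    have : (frame M α).e x * (kerrJ M α x).transpose
        = (Jf M α).map (fun f => f.val x) * (frame M α).e x := by
      rw [kerrJ_transpose hx, mul_assoc, ← mul_assoc, (frame M α).mul_eq_one x hx, one_mul]
    have := congrFun (congrFun this d) i
    rwa [Matrix.mul_apply, Matrix.mul_apply] at this
  have hlee : ∀ i, leeForm (kerrMetric M α) (kerrJ M α) x i
      = -∑ d, ![0, 0, -(2 * α * Real.sin (x 2) ^ 2 / kerrRho α x),
        -(2 * kerrDelta M α x / kerrRho α x)] d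
          * ∑ c, (Jf M α d c).val x * (e M α c i).val x := fun i => by
    rw [leeForm]
    simp only [hdiv, Finset.sum_mul, mul_assoc]
    rw [Finset.sum_comm]
    simp only [← Finset.mul_sum, hJ]
  have hD0 : kerrDelta M α x ≠ 0 := hx.1.ne'
  have hs := sin_ne_zero hx
  funext i
  rw [hlee]
  revert i
  refine forall_fin_four ?_ ?_ ?_ ?_ <;> simp [Jf, e, Fin.sum_univ_four]
  all_goals field_simp

/-! ### The fundamental two-form and the equation for its exterior derivative -/

/-- The components of the fundamental two-form. -/
noncomputable def Om (M α : ℝ) : Matrix (Fin 4) (Fin 4) (Fun M α) :=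
  !![0, (-1 : ℝ), -(α * s M α), 0;
    1, 0, 0, -(α * s M α ^ 2);
    α * s M α, 0, 0, s M α * (r M α ^ 2 - (α ^ 2 : ℝ));
    0, α * s M α ^ 2, -(s M α * (r M α ^ 2 - (α ^ 2 : ℝ))), 0]

theorem kerrOmega_eq {x : Fin 4 → ℝ} (hx : x ∈ kerrDomain M α) : ∀ i j,
    kerrOmega M α x i j = (Om M α i j).val x := by
  have h1 : ∀ i j, kerrOmega M α x i j
      = ∑ a, ∑ b, (e M α a i).val x * ((Jf M α b a).val x * (h M α b).val x)
        * (e M α b j).val x := fun i j => by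
    -- As matrices `ω = J g`; substituting the frame expressions of both factors cancels `e E` in
    -- the middle.
    have h2 : kerrOmega M α x = ((frame M α).e x).transpose
        * (((Jf M α).map fun f => f.val x).transpose
          * Matrix.diagonal ((frame M α).h x)) * (frame M α).e x := by
      calc kerrOmega M α x = kerrJ M α x * kerrMetric M α x := by
            ext i j
            rw [kerrOmega, Matrix.of_apply, Matrix.mul_apply]
        _ = (((frame M α).e x).transpose * ((Jf M α).map fun f => f.val x).transpose)
            * ((frame M α).e x * (frame M α).E x).transpose
            * Matrix.diagonal ((frame M α).h x) * (frame M α).e x := by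
          rw [(frame M α).metric_eq x hx, ← Matrix.transpose_transpose (kerrJ M α x),
            kerrJ_transpose hx]
          simp only [Matrix.transpose_mul, mul_assoc]
        _ = _ := by
          rw [(frame M α).mul_eq_one x hx, Matrix.transpose_one]
          simp only [mul_one, mul_assoc]
    rw [h2, Matrix.mul_apply, Finset.sum_comm]
    refine Finset.sum_congr rfl fun b _ => ?_
    rw [Matrix.mul_apply, Finset.sum_mul]
    refine Finset.sum_congr rfl fun a _ => ?_
    rw [Matrix.mul_diagonal]
    rfl
  have hD0 : kerrDelta M α x ≠ 0 := hx.1.ne'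
  have hX0 : kerrXi α x ≠ 0 := hx.2.1.ne'
  have hs := sin_ne_zero hx
  have hX' := kerrXi_eq (α := α) x
  simp only [h1]
  clear hx h1
  refine forall_fin_four ?_ ?_ ?_ ?_ <;> refine forall_fin_four ?_ ?_ ?_ ?_ <;>
    simp [Jf, e, h, Om, Fin.sum_univ_four]
  all_goals
    field_simp
    try clear hD0 hX0 hs
    try grind

theorem extDer_kerrOmega {x : Fin 4 → ℝ} (hx : x ∈ kerrDomain M α) (i j k : Fin 4) :
    extDer (kerrOmega M α) x i j k
      = (Om M α j k).d i x + (Om M α k i).d j x + (Om M α i j).d k x := by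
  have : ∀ i j k, pd i (fun y => kerrOmega M α y j k) x = (Om M α j k).d i x := fun i j k =>
    (((Om M α j k).hasPd x hx i).congr (isOpen_kerrDomain M α) hx
      fun y hy => kerrOmega_eq hy j k).pd_eq
  rw [extDer, this, this, this]

set_option maxHeartbeats 1000000 in
theorem extDer_eq_wedge {x : Fin 4 → ℝ} (hx : x ∈ kerrDomain M α) : ∀ i j k,
    extDer (kerrOmega M α) x i j k = wedgeOneTwo
      ![0, 2 / kerrRho α x, 2 * α * Real.sin (x 2) / kerrRho α x, 0] (kerrOmega M α x) i j k := by
  have hρ := kerrRho_ne_zero hx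
  have hρ' : kerrRho α x = x 1 - α * Real.cos (x 2) := rfl
  have hc := Real.cos_sq_add_sin_sq (x 2)
  simp only [extDer_kerrOmega hx, wedgeOneTwo, kerrOmega_eq hx]
  clear hx
  refine forall_fin_four ?_ ?_ ?_ ?_ <;> refine forall_fin_four ?_ ?_ ?_ ?_ <;>
    refine forall_fin_four ?_ ?_ ?_ ?_ <;> simp [Om]
  all_goals
    try field_simp
    try clear hρ
    grind

/-- In dimension four, wedging covectors with a nondegenerate two-form is injective. The factor `sin
θ · Ξ` found below is, up to sign, the Pfaffian of `ω`. -/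
theorem eq_of_wedge_eq {x : Fin 4 → ℝ} (hx : x ∈ kerrDomain M α) {η ξ : Fin 4 → ℝ}
    (hw : ∀ i j k, wedgeOneTwo η (kerrOmega M α x) i j k
      = wedgeOneTwo ξ (kerrOmega M α x) i j k) : η = ξ := by
  have hX0 : kerrXi α x ≠ 0 := hx.2.1.ne'
  have hs := sin_ne_zero hx
  have hX' := kerrXi_eq (α := α) x
  have h1 := hw 0 1 2
  have h2 := hw 0 1 3
  have h3 := hw 0 2 3
  have h4 := hw 1 2 3
  simp [wedgeOneTwo, kerrOmega_eq hx, Om] at h1 h2 h3 h4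
  have h5 : η 1 = ξ 1 := by
    have : (Real.sin (x 2) * kerrXi α x) * (η 1 - ξ 1) = 0 := by
      rw [hX']
      linear_combination h4 + α * Real.sin (x 2) ^ 2 * h1
    exact sub_eq_zero.1 ((mul_eq_zero.1 this).resolve_left (mul_ne_zero hs hX0))
  have h6 : η 0 = ξ 0 := by
    have : (Real.sin (x 2) * kerrXi α x) * (η 0 - ξ 0) = 0 := by
      rw [hX']
      linear_combination h3 - α * Real.sin (x 2) * h2
    exact sub_eq_zero.1 ((mul_eq_zero.1 this).resolve_left (mul_ne_zero hs hX0))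
  rw [h5] at h1
  rw [h6] at h2
  funext i
  revert i
  refine forall_fin_four h6 h5 ?_ ?_
  · linarith
  · linarith

theorem wedge_iff {x : Fin 4 → ℝ} (hx : x ∈ kerrDomain M α) (η : Fin 4 → ℝ) :
    (∀ i j k, extDer (kerrOmega M α) x i j k = wedgeOneTwo η (kerrOmega M α x) i j k) ↔
      η = leeForm (kerrMetric M α) (kerrJ M α) x := by
  rw [leeForm_eq hx]
  constructor
  · intro h
    exact eq_of_wedge_eq hx fun i j k => by rw [← h, extDer_eq_wedge hx]
  · rintro rfl
    exact extDer_eq_wedge hx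

/-! ### Potentials of the Lee form and the conformal factor -/

theorem hasFDerivAt_log {x : Fin 4 → ℝ} (hx : x ∈ kerrDomain M α) {C : ℝ} (hC : 0 < C) :
    HasFDerivAt (fun y => Real.log (C * kerrRho α y ^ 2))
      (covector (leeForm (kerrMetric M α) (kerrJ M α) x)) x := by
  have hρ := kerrRho_ne_zero hx
  have h1 : HasFDerivAt (fun y : Fin 4 → ℝ => y 1)
    (ContinuousLinearMap.proj (R := ℝ) (φ := fun _ : Fin 4 => ℝ) 1) x := hasFDerivAt_apply 1 x
  have h2 : HasFDerivAt (fun y : Fin 4 → ℝ => y 2)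
    (ContinuousLinearMap.proj (R := ℝ) (φ := fun _ : Fin 4 => ℝ) 2) x := hasFDerivAt_apply 2 x
  have h3 := h1.sub (h2.cos.const_mul α)
  have h4 := ((h3.pow 2).const_mul C).log (mul_ne_zero hC.ne' (pow_ne_zero 2 hρ))
  refine h4.congr_fderiv ?_
  rw [leeForm_eq hx]
  have hρ' : kerrRho α x = x 1 - α * Real.cos (x 2) := rfl
  rw [hρ'] at hρ ⊢
  ext v
  simp [covector, Fin.sum_univ_four]
  field_simp

theorem conformal_factor (hM : 0 < M) {x : Fin 4 → ℝ} (hx : x ∈ kerrDomain M α) :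
    eigenNorm (kerrWPlus M α x) ^ (2 / 3 : ℝ)
      = Real.exp (-Real.log
          ((6 : ℝ) ^ (-1 / 3 : ℝ) * M ^ (-2 / 3 : ℝ) * kerrRho α x ^ 2)) := by
  have hρ := kerrRho_ne_zero hx
  have hpos : 0 < (6 : ℝ) ^ (-1 / 3 : ℝ) * M ^ (-2 / 3 : ℝ) * kerrRho α x ^ 2 := by positivity
  rw [wPlus_norm hM hx, Real.exp_neg, Real.exp_log hpos, neg_div, neg_div,
    Real.rpow_neg (by norm_num), Real.rpow_neg hM.le]
  have h1 : (6 : ℝ) ^ (1 / 3 : ℝ) ≠ 0 := by positivity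
  have h2 : M ^ (2 / 3 : ℝ) ≠ 0 := by positivity
  field_simp

theorem conformal_factor_of_potential (hM : 0 < M) {V : Set (Fin 4 → ℝ)}
    (hV : V ⊆ kerrDomain M α) (hVo : IsOpen V) (hVc : IsPreconnected V) {f : (Fin 4 → ℝ) → ℝ}
    (hf : ∀ x ∈ V, HasFDerivAt f (covector (leeForm (kerrMetric M α) (kerrJ M α) x)) x) :
    ∃ c : ℝ, 0 < c ∧ ∀ x ∈ V,
      eigenNorm (kerrWPlus M α x) ^ (2 / 3 : ℝ) = c * Real.exp (-f x) := by
  have hg : ∀ x ∈ V, HasFDerivAt (fun y => Real.log (1 * kerrRho α y ^ 2))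
      (covector (leeForm (kerrMetric M α) (kerrJ M α) x)) x :=
    fun x hx => hasFDerivAt_log (hV hx) one_pos
  -- Two potentials of the same form on a connected open set differ by a constant `a`. The factor
  -- `exp a` in the witness compensates the `exp (-a)` contained in `exp (-f)`.
  obtain ⟨a, ha⟩ := hVo.exists_eq_add_of_fderiv_eq hVc
    (fun x hx => (hf x hx).differentiableAt.differentiableWithinAt)
    (fun x hx => (hg x hx).differentiableAt.differentiableWithinAt)
    (fun x hx => (hf x hx).fderiv.trans (hg x hx).fderiv.symm)
  refine ⟨(6 : ℝ) ^ (1 / 3 : ℝ) * M ^ (2 / 3 : ℝ) * Real.exp a, by positivity, fun x hx => ?_⟩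
  have hρ := kerrRho_ne_zero (hV hx)
  have hpos : 0 < kerrRho α x ^ 2 := by positivity
  have hfx : f x = Real.log (1 * kerrRho α x ^ 2) + a := ha hx
  rw [wPlus_norm hM (hV hx), hfx, one_mul, neg_add, Real.exp_add, Real.exp_neg (Real.log _),
    Real.exp_log hpos, Real.exp_neg a]
  have := Real.exp_ne_zero a
  field_simp

end Kerr

theorem mainTheorem4 (M α : ℝ) (hM : 0 < M) (hα : 0 < α) :
    -- curvature: Ricci-flatness, the matrix of `W⁺`, its eigenvalues and its norm
    (∀ x ∈ kerrDomain M α,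
      (∀ i j, ricci (kerrMetric M α) x i j = 0) ∧
      scalarCurv (kerrMetric M α) x = 0 ∧
      kerrA M α x = kerrWPlus M α x
        + (scalarCurv (kerrMetric M α) x / 12) • (1 : Matrix (Fin 3) (Fin 3) ℝ) ∧
      kerrA M α x = kerrWPlus M α x ∧
      kerrWPlus M α x = Matrix.diagonal
        ![-M / kerrRho α x ^ 3, -M / kerrRho α x ^ 3, 2 * M / kerrRho α x ^ 3] ∧
      (∀ p : Fin 3,
        formOperator (frameComp (kerrFrame M α x) (weyl (kerrMetric M α) x)) (selfDualBasis p)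
          = (![-M / kerrRho α x ^ 3, -M / kerrRho α x ^ 3, 2 * M / kerrRho α x ^ 3] p)
            • selfDualBasis p) ∧
      kerrWPlus M α x ≠ 0 ∧
      (kerrWPlus M α x).charpoly.roots
        = {-M / kerrRho α x ^ 3, -M / kerrRho α x ^ 3, 2 * M / kerrRho α x ^ 3} ∧
      {μ : ℝ | Module.End.HasEigenvalue (Matrix.toLin' (kerrWPlus M α x)) μ}.ncard = 2 ∧
      eigenNorm (kerrWPlus M α x) ^ (2 / 3 : ℝ)
        = (6 : ℝ) ^ (1 / 3 : ℝ) * M ^ (2 / 3 : ℝ) / kerrRho α x ^ 2) ∧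
    -- the Lee form: its value, the equation `dω = ξ ∧ ω` that determines it, its exactness
    (∀ x ∈ kerrDomain M α,
      leeForm (kerrMetric M α) (kerrJ M α) x
        = ![0, 2 / kerrRho α x, 2 * α * Real.sin (x 2) / kerrRho α x, 0] ∧
      (∀ η : Fin 4 → ℝ,
        (∀ i j k, extDer (kerrOmega M α) x i j k = wedgeOneTwo η (kerrOmega M α x) i j k) ↔
          η = leeForm (kerrMetric M α) (kerrJ M α) x) ∧
      (∀ C : ℝ, 0 < C →
        HasFDerivAt (fun y => Real.log (C * kerrRho α y ^ 2))
          (covector (leeForm (kerrMetric M α) (kerrJ M α) x)) x)) ∧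
    -- agreement of the two conformal factors
    (∀ x ∈ kerrDomain M α,
      Real.exp (-Real.log (kerrRho α x ^ 2)) = 1 / kerrRho α x ^ 2 ∧
      eigenNorm (kerrWPlus M α x) ^ (2 / 3 : ℝ)
        = Real.exp (-Real.log
            ((6 : ℝ) ^ (-1 / 3 : ℝ) * M ^ (-2 / 3 : ℝ) * kerrRho α x ^ 2))) ∧
    (∀ V : Set (Fin 4 → ℝ), V ⊆ kerrDomain M α → IsOpen V → IsPreconnected V →
      ∀ f : (Fin 4 → ℝ) → ℝ,
        (∀ x ∈ V, HasFDerivAt f (covector (leeForm (kerrMetric M α) (kerrJ M α) x)) x) →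
        ∃ c : ℝ, 0 < c ∧ ∀ x ∈ V,
          eigenNorm (kerrWPlus M α x) ^ (2 / 3 : ℝ) = c * Real.exp (-f x)) := by
  refine ⟨fun x hx => ⟨Kerr.ricci_eq_zero hx, Kerr.scalarCurv_eq_zero hx, ?_, Kerr.kerrA_eq hx,
    Kerr.wPlus_eq hx, Kerr.formOperator_weyl hx, Kerr.wPlus_ne_zero hM hx, Kerr.wPlus_roots hx,
    ?_, Kerr.wPlus_norm hM hx⟩, fun x hx => ⟨Kerr.leeForm_eq hx, Kerr.wedge_iff hx,
    fun C hC => Kerr.hasFDerivAt_log hx hC⟩, fun x hx => ⟨?_, Kerr.conformal_factor hM hx⟩,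
    fun V hV hVo hVc f hf => Kerr.conformal_factor_of_potential hM hV hVo hVc hf⟩
  · rw [Kerr.kerrA_eq hx, Kerr.scalarCurv_eq_zero hx, zero_div, zero_smul, add_zero]
  · rw [Kerr.wPlus_eq hx]
    exact ncard_eigenvalue_diagonal (Kerr.eigenvalue_ne hM hx)
  · have := Kerr.kerrRho_ne_zero hx
    rw [Real.exp_neg, Real.exp_log (by positivity), one_div]
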